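/- A ground ring is a commutative unital ring $S$ with parameters $\rho$, $q$, $\delta_j$ ($j\ge 0$), $u_1,\dots,u_r\in S$ such that $\rho,q,\delta_0,u_1,\dots,u_r$ are invertible and $\rho^{-1}-\rho=(q^{-1}-q)(\delta_0-1)$; it is integral if $S$ is an integral domain. Put $a_j=(-1)^{r-j}\varepsilon_{r-j}(u_1,\dots,u_r)$ for $0\le j\le r$, where $\varepsilon_k$ is the $k$-th elementary symmetric function, and for $j\ge1$ define recursively $$\delta_{-j}=\rho^{-2}\delta_j+(q^{-1}-q)\rho^{-1}\sum_{k=1}^{j-1}(\delta_k\delta_{k-j}-\delta_{2k-j}).$$ $S$ is weakly admissible if $\sum_{k=0}^r a_k\delta_{k+b}=0$ for all $b\in\mathbb Z$. Let $W_2$ be the cyclotomic BMW algebra on two strands: the unital associative $S$-algebra with generators $y^{\pm1},g^{\pm1},e$ and relations $yy^{-1}=y^{-1}y=1$, $gg^{-1}=g^{-1}g=1$, $e^2=\delta_0e$, $ygyg=gygy$, $ey^je=\delta_je$ ($j\ge1$), $g-g^{-1}=(q-q^{-1})(1-e)$, $ge=eg=\rho^{-1}e$, $eygy=\rho e=ygye$,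 $(y-u_1)\cdots(y-u_r)=0$. Consider the following conditions. (L) $S$ is weakly admissible and $e,ye,\dots,y^{r-1}e$ are linearly independent over $S$ in $W_2$. (M) $S$ is weakly admissible and there is a $W_2$-module with an $S$-basis $v_0,yv_0,\dots,y^{r-1}v_0$ such that $ev_0=\delta_0v_0$. (R) For $1\le\ell\le r-1$, $$\rho\Big(a_\ell-\frac{a_{r-\ell}}{a_0}\Big)+(q-q^{-1})\Big[\sum_{j=1}^{r-\ell}a_{j+\ell}\delta_j-\sum_{j=\max(\ell+1,\lceil r/2\rceil)}^{\lfloor(\ell+r)/2\rfloor}a_{2j-\ell}+\sum_{j=\lceil\ell/2\rceil}^{\min(\ell,\lceil r/2\rceil-1)}a_{2j-\ell}\Big]=0;$$ moreover $\rho^{-1}a_0-\rho a_0^{-1}$ equals $0$ if $r$ is odd and $q-q^{-1}$ if $r$ is even; and $\delta_b=-\sum_{j=0}^{r-1}a_j\delta_{b-r+j}$ for all $b\ge r$. (G) (for integral $S$ with the $u_i$ distinct and $q-q^{-1}\neq 0$) For all $b\ge0$, $\delta_b=\sum_{j=1}^r\gamma_ju_j^b$ in the field of fractions of $S$, where $$\gamma_j=\prod_{\ell\ne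 j}\frac{u_\ell u_j-1}{u_j-u_\ell}\Big(\frac{1-u_j^2}{\rho(q^{-1}-q)}\prod_{\ell\ne j}u_\ell+\eta_j\Big),\qquad \eta_j=1\text{ if } r \text{ is odd},\quad \eta_j=-u_j\text{ if } r\text{ is even}.$$ A ground ring $S$ is called admissible if $q-q^{-1}$ is non-zero and not a zero-divisor and the conditions (L), (R), (M), which are equivalent in this case, hold. An integral ground ring $S$ is called $u$-admissible if $q-q^{-1}\ne0$, $u_i\ne u_j$ for $i\ne j$, $u_iu_j\ne1$ for all $i,j$, and the conditions (L), (G), (M), which are equivalent in this case, hold. Corollary. Let $S$ be an integral ground ring. Then $S$ is $u$-admissible if and only if $S$ is admissible, the $u_i$ are distinct, and $u_iu_j\ne1$ for all $i,j$ (including $i=j$). This holds whichever of (L), (G), (M) is taken as the condition in the definition of $u$-admissibility and whichever of (L), (R), (M) is taken as the condition in the definition of admissibility. -/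

import Mathlib

open scoped BigOperators

universe u

/-- The data making a commutative ring `S` a ground ring: parameters `ρ`, `q`, `δ j` (`j ≥ 0`) and
`u 0, …, u (r - 1)`, with `ρ`, `q`, `δ 0` and all `u i` invertible, satisfying
`ρ⁻¹ - ρ = (q⁻¹ - q) (δ 0 - 1)`. -/
structure GroundRingParameters (S : Type u) [CommRing S] (r : ℕ) where
  ρ : Sˣ
  q : Sˣ
  δ : ℕ → S
  u : Fin r → Sˣ
  isUnit_δ_zero : IsUnit (δ 0)
  relation : ((ρ⁻¹ : Sˣ) : S) - (ρ : S) = (((q⁻¹ : Sˣ) : S) - (q : S)) * (δ 0 - 1)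

/-- The generators `y₁^{±1}`, `g_i^{±1}`, `e_i` (`1 ≤ i ≤ n - 1`) of the `n`-strand algebra. The index
`i : Fin (n - 1)` stands for the index `i + 1` of the usual numbering. -/
inductive BMWGenerator (n : ℕ) : Type
  | y : BMWGenerator n
  | yInv : BMWGenerator n
  | g (i : Fin (n - 1)) : BMWGenerator n
  | gInv (i : Fin (n - 1)) : BMWGenerator n
  | e (i : Fin (n - 1)) : BMWGenerator n

namespace GroundRingParameters

section Algebra

variable {S : Type u} [CommRing S] {r : ℕ}

/-- The element `q - q⁻¹`. -/
def qDiff (P : GroundRingParameters S r) : S := (P.q : S) - ((P.q⁻¹ : Sˣ) : S)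

/-- The signed elementary symmetric functions `a_j = (-1)^{r-j} ε_{r-j}(u_1, …, u_r)`; they are used
for `0 ≤ j ≤ r` only. -/
def a (P : GroundRingParameters S r) (j : ℕ) : S :=
  (-1) ^ (r - j) * ((Finset.univ : Finset (Fin r)).val.map (fun i => (P.u i : S))).esymm (r - j)

/-- `P.negδ j` is the element `δ_{-j}`. -/
def negδ (P : GroundRingParameters S r) : ℕ → S
  | 0 => P.δ 0
  | j + 1 =>
    ((P.ρ⁻¹ : Sˣ) : S) ^ 2 * P.δ (j + 1) +
      (((P.q⁻¹ : Sˣ) : S) - (P.q : S)) * ((P.ρ⁻¹ : Sˣ) : S) *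
        ∑ k ∈ Finset.range j,
          (P.δ (k + 1) * negδ P (j - k) -
            if j + 1 ≤ 2 * (k + 1) then P.δ (2 * (k + 1) - (j + 1))
            else negδ P (j + 1 - 2 * (k + 1)))
termination_by j => j
decreasing_by all_goals omega

/-- The family `δ_a`, extended to all integers `a`. -/
def δInt (P : GroundRingParameters S r) : ℤ → S
  | Int.ofNat j => P.δ j
  | Int.negSucc j => P.negδ (j + 1)

theorem δInt_natCast (P : GroundRingParameters S r) (j : ℕ) : P.δInt (j : ℤ) = P.δ j := rfl

theorem δInt_neg_natCast (P : GroundRingParameters S r) (j : ℕ) :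
    P.δInt (-(j : ℤ)) = P.negδ j := by
  cases j with
  | zero => simp [negδ, δInt]
  | succ j => rfl

/-- The recursion that determines the elements `δ_{-j}` (for `j = 1` the sum is empty). -/
theorem δInt_neg (P : GroundRingParameters S r) (j : ℕ) (hj : 1 ≤ j) :
    P.δInt (-(j : ℤ)) =
      ((P.ρ⁻¹ : Sˣ) : S) ^ 2 * P.δInt (j : ℤ) +
        (((P.q⁻¹ : Sˣ) : S) - (P.q : S)) * ((P.ρ⁻¹ : Sˣ) : S) *
          ∑ k ∈ Finset.Icc 1 (j - 1),
            (P.δInt (k : ℤ) * P.δInt ((k : ℤ) - j) - P.δInt (2 * (k : ℤ) - j)) := by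
  obtain ⟨m, rfl⟩ : ∃ m, j = m + 1 := ⟨j - 1, by omega⟩
  rw [δInt_neg_natCast, negδ, δInt_natCast]
  congr 2
  have hI : Finset.Icc 1 (m + 1 - 1) = Finset.Ico 1 (m + 1) := by
    ext x
    simp only [Finset.mem_Icc, Finset.mem_Ico]
    omega
  rw [hI, Finset.sum_Ico_eq_sum_range]
  refine Finset.sum_congr (by simp) ?_
  intro k hk
  have hk' : k < m := Finset.mem_range.mp hk
  have h1 : (((1 + k : ℕ) : ℤ) - ((m + 1 : ℕ) : ℤ)) = -((m - k : ℕ) : ℤ) := by omega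
  rw [h1, δInt_neg_natCast, δInt_natCast, Nat.add_comm 1 k]
  congr 1
  split_ifs with h
  · have h2 : (2 * ((k + 1 : ℕ) : ℤ) - ((m + 1 : ℕ) : ℤ)) =
        ((2 * (k + 1) - (m + 1) : ℕ) : ℤ) := by omega
    rw [h2, δInt_natCast]
  · have h2 : (2 * ((k + 1 : ℕ) : ℤ) - ((m + 1 : ℕ) : ℤ)) =
        -((m + 1 - 2 * (k + 1) : ℕ) : ℤ) := by omega
    rw [h2, δInt_neg_natCast]

/-- Weak admissibility: `∑_{k=0}^r (-1)^{r-k} ε_{r-k}(u) δ_{k+a} = 0` for all integers `a`. -/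
def IsWeaklyAdmissible (P : GroundRingParameters S r) : Prop :=
  ∀ b : ℤ, ∑ k ∈ Finset.range (r + 1), P.a k * P.δInt ((k : ℤ) + b) = 0

/-- The generator `y₁` of the free algebra. -/
abbrev freeY (S : Type u) [CommRing S] (n : ℕ) : FreeAlgebra S (BMWGenerator n) :=
  FreeAlgebra.ι S BMWGenerator.y

/-- The generator `y₁⁻¹` of the free algebra. -/
abbrev freeYInv (S : Type u) [CommRing S] (n : ℕ) : FreeAlgebra S (BMWGenerator n) :=
  FreeAlgebra.ι S BMWGenerator.yInv

/-- The generator `g_i` of the free algebra. -/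
abbrev freeG (S : Type u) [CommRing S] {n : ℕ} (i : Fin (n - 1)) :
    FreeAlgebra S (BMWGenerator n) :=
  FreeAlgebra.ι S (BMWGenerator.g i)

/-- The generator `g_i⁻¹` of the free algebra. -/
abbrev freeGInv (S : Type u) [CommRing S] {n : ℕ} (i : Fin (n - 1)) :
    FreeAlgebra S (BMWGenerator n) :=
  FreeAlgebra.ι S (BMWGenerator.gInv i)

/-- The generator `e_i` of the free algebra. -/
abbrev freeE (S : Type u) [CommRing S] {n : ℕ} (i : Fin (n - 1)) :
    FreeAlgebra S (BMWGenerator n) :=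
  FreeAlgebra.ι S (BMWGenerator.e i)

/-- The indices `i` and `j` differ by exactly one. -/
def Adjacent {m : ℕ} (i j : Fin m) : Prop := i.val + 1 = j.val ∨ j.val + 1 = i.val

/-- The indices `i` and `j` differ by at least two. -/
def Distant {m : ℕ} (i j : Fin m) : Prop := i.val + 2 ≤ j.val ∨ j.val + 2 ≤ i.val

/-- The defining relations of the cyclotomic BMW algebra on `n` strands. An index with value `0` is the
first one (`g₁`, `e₁`), an index `i` with `1 ≤ i.val` is one of the others. -/
inductive BMWRel (P : GroundRingParameters S r) (n : ℕ) :
    FreeAlgebra S (BMWGenerator n) → FreeAlgebra S (BMWGenerator n) → Prop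
  -- inverses
  | g_mul_gInv (i : Fin (n - 1)) : BMWRel P n (freeG S i * freeGInv S i) 1
  | gInv_mul_g (i : Fin (n - 1)) : BMWRel P n (freeGInv S i * freeG S i) 1
  | y_mul_yInv : BMWRel P n (freeY S n * freeYInv S n) 1
  | yInv_mul_y : BMWRel P n (freeYInv S n * freeY S n) 1
  -- idempotent relation
  | e_mul_e (i : Fin (n - 1)) : BMWRel P n (freeE S i * freeE S i) (P.δ 0 • freeE S i)
  -- affine braid relations
  | braid (i j : Fin (n - 1)) (h : i.val + 1 = j.val) :
      BMWRel P n (freeG S i * freeG S j * freeG S i) (freeG S j * freeG S i * freeG S j)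
  | g_comm_g (i j : Fin (n - 1)) (h : Distant i j) :
      BMWRel P n (freeG S i * freeG S j) (freeG S j * freeG S i)
  | affine_braid (i : Fin (n - 1)) (h : i.val = 0) :
      BMWRel P n (freeY S n * freeG S i * freeY S n * freeG S i)
        (freeG S i * freeY S n * freeG S i * freeY S n)
  | y_comm_g (i : Fin (n - 1)) (h : 1 ≤ i.val) :
      BMWRel P n (freeY S n * freeG S i) (freeG S i * freeY S n)
  -- commutation relations
  | g_comm_e (i j : Fin (n - 1)) (h : Distant i j) :
      BMWRel P n (freeG S i * freeE S j) (freeE S j * freeG S i)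
  | e_comm_e (i j : Fin (n - 1)) (h : Distant i j) :
      BMWRel P n (freeE S i * freeE S j) (freeE S j * freeE S i)
  | y_comm_e (i : Fin (n - 1)) (h : 1 ≤ i.val) :
      BMWRel P n (freeY S n * freeE S i) (freeE S i * freeY S n)
  -- affine tangle relations
  | e_e_e (i j : Fin (n - 1)) (h : Adjacent i j) :
      BMWRel P n (freeE S i * freeE S j * freeE S i) (freeE S i)
  | g_g_e (i j : Fin (n - 1)) (h : Adjacent i j) :
      BMWRel P n (freeG S i * freeG S j * freeE S i) (freeE S j * freeE S i)
  | e_g_g (i j : Fin (n - 1)) (h : Adjacent i j) :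
      BMWRel P n (freeE S i * freeG S j * freeG S i) (freeE S i * freeE S j)
  | e_y_pow_e (i : Fin (n - 1)) (h : i.val = 0) (j : ℕ) (hj : 1 ≤ j) :
      BMWRel P n (freeE S i * freeY S n ^ j * freeE S i) (P.δ j • freeE S i)
  -- Kauffman skein relation
  | skein (i : Fin (n - 1)) :
      BMWRel P n (freeG S i - freeGInv S i) (P.qDiff • (1 - freeE S i))
  -- untwisting relations
  | g_e (i : Fin (n - 1)) :
      BMWRel P n (freeG S i * freeE S i) (((P.ρ⁻¹ : Sˣ) : S) • freeE S i)
  | e_g (i : Fin (n - 1)) :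
      BMWRel P n (freeE S i * freeG S i) (((P.ρ⁻¹ : Sˣ) : S) • freeE S i)
  | e_g_e (i j : Fin (n - 1)) (h : Adjacent i j) :
      BMWRel P n (freeE S i * freeG S j * freeE S i) ((P.ρ : S) • freeE S i)
  -- unwrapping relations
  | e_y_g_y (i : Fin (n - 1)) (h : i.val = 0) :
      BMWRel P n (freeE S i * freeY S n * freeG S i * freeY S n) ((P.ρ : S) • freeE S i)
  | y_g_y_e (i : Fin (n - 1)) (h : i.val = 0) :
      BMWRel P n (freeY S n * freeG S i * freeY S n * freeE S i) ((P.ρ : S) • freeE S i)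
  -- cyclotomic relation `(y₁ - u₁) ⋯ (y₁ - u_r) = 0`
  | cyclotomic :
      BMWRel P n
        (List.ofFn fun i : Fin r =>
          freeY S n - algebraMap S (FreeAlgebra S (BMWGenerator n)) (P.u i : S)).prod 0

/-- The cyclotomic BMW algebra `W_{n,S,r}(u_1, …, u_r)`. -/
abbrev CyclotomicBMW (P : GroundRingParameters S r) (n : ℕ) : Type u := RingQuot (P.BMWRel n)

/-- The element `y₁` of the two-strand algebra `W_{2,S,r}`. -/
def y (P : GroundRingParameters S r) : P.CyclotomicBMW 2 :=
  RingQuot.mkAlgHom S (P.BMWRel 2) (freeY S 2)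

/-- The element `e = e₁` of the two-strand algebra `W_{2,S,r}`. -/
def e (P : GroundRingParameters S r) : P.CyclotomicBMW 2 :=
  RingQuot.mkAlgHom S (P.BMWRel 2) (freeE S (n := 2) 0)

/-- `S` is weakly admissible and `e, y₁ e, …, y₁^{r-1} e` are linearly independent in `W_{2,S,r}`. -/
def LinearIndependenceCondition (P : GroundRingParameters S r) : Prop :=
  P.IsWeaklyAdmissible ∧ LinearIndependent S (fun k : Fin r => P.y ^ (k : ℕ) * P.e)

/-- `S` is weakly admissible and there is a `W_{2,S,r}`-module `M` with an `S`-basis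
`v₀, y₁ v₀, …, y₁^{r-1} v₀` such that `e v₀ = δ₀ v₀`. -/
def BasisModuleCondition (P : GroundRingParameters S r) : Prop :=
  P.IsWeaklyAdmissible ∧
    ∃ (M : Type u) (_ : AddCommGroup M) (_ : Module S M) (_ : Module (P.CyclotomicBMW 2) M)
      (_ : IsScalarTower S (P.CyclotomicBMW 2) M) (v₀ : M) (b : Module.Basis (Fin r) S M),
      (∀ k : Fin r, b k = P.y ^ (k : ℕ) • v₀) ∧ P.e • v₀ = P.δ 0 • v₀

/-- The explicit relations of Wilcox and Yu among the parameters. Here `a₀⁻¹` is written as the product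
`(-1)^r ∏ u_i⁻¹`, the natural numbers `(r + 1) / 2` and `(l + 1) / 2` are the ceilings of `r / 2` and
`l / 2`, and empty sums are zero. -/
def WilcoxYuCondition (P : GroundRingParameters S r) : Prop :=
  (∀ l ∈ Finset.Icc 1 (r - 1),
    (P.ρ : S) * (P.a l - P.a (r - l) * ((-1) ^ r * ∏ i, (((P.u i)⁻¹ : Sˣ) : S))) +
      P.qDiff *
        (∑ j ∈ Finset.Icc 1 (r - l), P.a (j + l) * P.δ j
          - ∑ j ∈ Finset.Icc (max (l + 1) ((r + 1) / 2)) ((l + r) / 2), P.a (2 * j - l)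
          + ∑ j ∈ Finset.Icc ((l + 1) / 2) (min l ((r + 1) / 2 - 1)), P.a (2 * j - l)) = 0) ∧
  ((P.ρ⁻¹ : Sˣ) : S) * P.a 0 - (P.ρ : S) * ((-1) ^ r * ∏ i, (((P.u i)⁻¹ : Sˣ) : S)) =
    (if Odd r then 0 else P.qDiff) ∧
  (∀ b : ℕ, r ≤ b → P.δ b = -∑ j ∈ Finset.range r, P.a j * P.δ (b - r + j))

/-- The element written `a₀⁻¹` in the relations above is the inverse of `a₀`. -/
theorem a_zero_mul_inv (P : GroundRingParameters S r) :
    P.a 0 * ((-1) ^ r * ∏ i, (((P.u i)⁻¹ : Sˣ) : S)) = 1 := by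
  have h : P.a 0 = (-1) ^ r * ∏ i, (P.u i : S) := by
    have hc : Finset.powersetCard r (Finset.univ : Finset (Fin r)) = {Finset.univ} := by
      simpa using Finset.powersetCard_self (Finset.univ : Finset (Fin r))
    simp only [a, Nat.sub_zero]
    rw [Finset.esymm_map_val, hc]
    simp
  rw [h, mul_mul_mul_comm, ← Finset.prod_mul_distrib, ← pow_add]
  simp

/-- The three equivalent conditions by which admissibility is defined. -/
inductive AdmissibilityForm : Type
  | linearIndependence
  | wilcoxYuRelations
  | basisModule

/-- The condition named by an `AdmissibilityForm`. -/
def AdmissibilityCondition (P : GroundRingParameters S r) : AdmissibilityForm → Prop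
  | .linearIndependence => P.LinearIndependenceCondition
  | .wilcoxYuRelations => P.WilcoxYuCondition
  | .basisModule => P.BasisModuleCondition

/-- Admissibility of the parameters, with the condition of form `c`: `q - q⁻¹` is non-zero and not a
zero-divisor, and the condition `c` holds. -/
def IsAdmissible (P : GroundRingParameters S r) (c : AdmissibilityForm) : Prop :=
  P.qDiff ≠ 0 ∧ P.qDiff ∈ nonZeroDivisors S ∧ P.AdmissibilityCondition c

end Algebra

section Integral

variable {S : Type u} [CommRing S] [IsDomain S] {r : ℕ}

/-- The image of `u_i` in the field of fractions. -/
noncomputable def uFrac (P : GroundRingParameters S r) (i : Fin r) : FractionRing S :=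
  algebraMap S (FractionRing S) (P.u i : S)

/-- The elements `γ_j` of the field of fractions of `S`. -/
noncomputable def γ (P : GroundRingParameters S r) (j : Fin r) : FractionRing S :=
  (∏ l ∈ Finset.univ.erase j, (P.uFrac l * P.uFrac j - 1) / (P.uFrac j - P.uFrac l)) *
    ((1 - P.uFrac j ^ 2) /
        algebraMap S (FractionRing S)
          ((P.ρ : S) * (((P.q⁻¹ : Sˣ) : S) - (P.q : S))) *
        ∏ l ∈ Finset.univ.erase j, P.uFrac l +
      if Odd r then 1 else -P.uFrac j)

/-- `δ_a = ∑_j γ_j u_j^a` for all `a ≥ 0`, an equation in the field of fractions of `S`. -/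
def DeltaFormulaCondition (P : GroundRingParameters S r) : Prop :=
  ∀ k : ℕ, algebraMap S (FractionRing S) (P.δ k) = ∑ j, P.γ j * P.uFrac j ^ k

/-- The three equivalent conditions by which `u`-admissibility is defined. -/
inductive UAdmissibilityForm : Type
  | linearIndependence
  | deltaFormula
  | basisModule

/-- The condition named by a `UAdmissibilityForm`. -/
def UAdmissibilityCondition (P : GroundRingParameters S r) : UAdmissibilityForm → Prop
  | .linearIndependence => P.LinearIndependenceCondition
  | .deltaFormula => P.DeltaFormulaCondition
  | .basisModule => P.BasisModuleCondition

/-- `u`-admissibility of the parameters, with the condition of form `c`: `q - q⁻¹ ≠ 0`, the `u_i` are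
distinct, `u_i u_j ≠ 1` for all `i, j` (including `i = j`), and the condition `c` holds. -/
def IsUAdmissible (P : GroundRingParameters S r) (c : UAdmissibilityForm) : Prop :=
  P.qDiff ≠ 0 ∧ (∀ i j : Fin r, i ≠ j → P.u i ≠ P.u j) ∧
    (∀ i j : Fin r, (P.u i : S) * (P.u j : S) ≠ 1) ∧ P.UAdmissibilityCondition c

end Integral

end GroundRingParameters

/-! Put z = q - q⁻¹ and p = ∏ (X - u_i), and let K be the field of fractions. When z ≠ 0, the u_i
are distinct and no u_i u_j is 1, each of (L), (M) and (R) is equivalent to (G). The corollary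
follows, since a non-zero element of a domain is not a zero-divisor.

The link is the linear system ρ⁻¹ + z/(u_i² - 1) + z ∑_j γ_j/(1 - u_j u_i) = 0 (`CauchySystem`).
Over the denominator ∏ (1 - u_j X), the fraction ∑_j γ_j/(1 - u_j X) = ∑_k (∑_j γ_j u_j^k) X^k has a
numerator of degree < r. The system prescribes the values of this numerator at the r nodes u_i, so
it must be `deltaNumerator`; its values at the points u_j⁻¹ then yield the formula for γ_j
(`cauchySystem_iff_eq_nodeWeight`).

(R) ⇔ (G): the conditions (R) are the coefficients of the identity (∑ δ_k X^k) ∏ (1 - u_j X) =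
`deltaNumerator` (`mk_mul_revNodePoly_iff_coeff`).

(G) ⇒ (M): let y act on K^r by multiplication with u, and e by f ↦ ⟨γ, f⟩ 1. The relation y g y = g
- z (1 - e) leaves one choice for g. The Cauchy system says that g 1 = ρ⁻¹ 1, and with it the other
relations of the algebra hold (`freeRep_rel`). Pairing g yʲ 1 with γ gives the recursion for δ_{-j},
hence weak admissibility. The S-span of the vectors (u_i^k)_i is stable under the action and is the
required module.

(M) ⇒ (L): evaluate at v₀ and use that δ₀ is a unit.

(L) ⇒ (G): the element yʳ g p(y) e = 0 can be written as a polynomial in y times e. By linear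
independence this polynomial is divisible by p, so it vanishes at every u_i, where its value is ∏ (1
- u_j u_i) ≠ 0 times the left-hand side of the Cauchy system. -/

/-! ### Partial fractions, the Cauchy system and its solution. -/

section Nodes

open Polynomial Finset

variable {K : Type*} [Field K] {r : ℕ}

/-- The monic polynomial with the roots `u i`. -/
noncomputable def nodePoly (u : Fin r → K) : K[X] := ∏ i, (X - C (u i))

/-- The reciprocal polynomial of `nodePoly u`. -/
noncomputable def revNodePoly (u : Fin r → K) : K[X] := ∏ i, (1 - C (u i) * X)

/-- The residue of `X ^ r` modulo `X ^ 2 - 1`. -/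
noncomputable def parityPoly (K : Type*) [Field K] (r : ℕ) : K[X] := if Odd r then X else 1

theorem nodePoly_eval_self (u : Fin r → K) (i : Fin r) : (nodePoly u).eval (u i) = 0 := by
  rw [nodePoly, eval_prod]
  exact prod_eq_zero (mem_univ i) (by simp)

theorem nodePoly_eval (u : Fin r → K) (x : K) : (nodePoly u).eval x = ∏ i, (x - u i) := by
  simp [nodePoly, eval_prod]

theorem revNodePoly_eval (u : Fin r → K) (x : K) :
    (revNodePoly u).eval x = ∏ i, (1 - u i * x) := by
  simp [revNodePoly, eval_prod]

theorem nodePoly_natDegree (u : Fin r → K) : (nodePoly u).natDegree = r := by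
  simp [nodePoly]

theorem nodePoly_monic (u : Fin r → K) : (nodePoly u).Monic :=
  monic_prod_of_monic _ _ fun i _ => monic_X_sub_C (u i)

theorem reverse_nodePoly (u : Fin r → K) : (nodePoly u).reverse = revNodePoly u := by
  have h (s : Finset (Fin r)) :
      (∏ i ∈ s, (X - C (u i))).reverse = ∏ i ∈ s, (1 - C (u i) * X) := by
    induction s using Finset.induction_on with
    | empty => simpa using reverse_C (1 : K)
    | insert a s ha ih =>
      rw [prod_insert ha, prod_insert ha, reverse_mul_of_domain, ih]
      congr 1
      rw [reverse, natDegree_X_sub_C, reflect_sub, reflect_C]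
      have : reflect 1 (X : K[X]) = 1 := by simp
      rw [this, pow_one]
  exact h univ

theorem revNodePoly_coeff (u : Fin r → K) {k : ℕ} (hk : k ≤ r) :
    (revNodePoly u).coeff k = (nodePoly u).coeff (r - k) := by
  rw [← reverse_nodePoly, coeff_reverse, nodePoly_natDegree, revAt_le hk]

theorem revNodePoly_coeff_eq_zero (u : Fin r → K) {k : ℕ} (hk : r < k) :
    (revNodePoly u).coeff k = 0 := by
  rw [← reverse_nodePoly, coeff_reverse, nodePoly_natDegree, revAt_eq_self_of_lt hk]
  exact coeff_eq_zero_of_natDegree_lt (by rwa [nodePoly_natDegree])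

theorem revNodePoly_degree_le (u : Fin r → K) : (revNodePoly u).degree ≤ r := by
  rw [degree_le_iff_coeff_zero]
  intro m hm
  exact revNodePoly_coeff_eq_zero u (by exact_mod_cast hm)

/-- Modulo `X ^ 2 - 1` the variable is its own inverse, so `X ^ r * p(X)` agrees with `X ^ r *
p(X⁻¹)`, the reciprocal polynomial, while `X ^ r` reduces to `parityPoly K r`. -/
theorem X_sq_sub_one_dvd (u : Fin r → K) :
    X ^ 2 - 1 ∣ parityPoly K r * nodePoly u - revNodePoly u := by
  have h1 : X ^ 2 - 1 ∣ X ^ r * nodePoly u - revNodePoly u := by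
    have h (s : Finset (Fin r)) :
        X ^ 2 - 1 ∣ X ^ #s * ∏ i ∈ s, (X - C (u i)) - ∏ i ∈ s, (1 - C (u i) * X) := by
      induction s using Finset.induction_on with
      | empty => simp
      | insert a s ha ih =>
        rw [prod_insert ha, prod_insert ha, card_insert_of_notMem ha]
        obtain ⟨c, hc⟩ := ih
        refine ⟨X * (X - C (u a)) * c + ∏ i ∈ s, (1 - C (u i) * X), ?_⟩
        linear_combination X * (X - C (u a)) * hc
    simpa [nodePoly, revNodePoly] using h univ
  have h2 : (X ^ 2 - 1 : K[X]) ∣ X ^ r - parityPoly K r := by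
    unfold parityPoly
    split_ifs with h
    · obtain ⟨k, rfl⟩ := h
      have : (X ^ (2 * k + 1) - X : K[X]) = X * ((X ^ 2) ^ k - 1) := by ring
      rw [this]
      exact (sub_one_dvd_pow_sub_one _ _).mul_left _
    · obtain ⟨k, rfl⟩ := Nat.not_odd_iff_even.mp h
      rw [← two_mul, pow_mul]
      exact sub_one_dvd_pow_sub_one _ _
  have := h1.sub (h2.mul_right (nodePoly u))
  convert this using 1
  ring

/-- The quotient of `parityPoly K r * nodePoly u - revNodePoly u` by `X ^ 2 - 1`. -/
noncomputable def quotPoly (u : Fin r → K) : K[X] := (X_sq_sub_one_dvd u).choose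

theorem quotPoly_spec (u : Fin r → K) :
    parityPoly K r * nodePoly u - revNodePoly u = (X ^ 2 - 1) * quotPoly u :=
  (X_sq_sub_one_dvd u).choose_spec

theorem quotPoly_degree_lt (u : Fin r → K) : (quotPoly u).degree < r := by
  by_contra! h
  have h1 : ((X ^ 2 - 1 : K[X]) * quotPoly u).degree = 2 + (quotPoly u).degree := by
    rw [degree_mul, ← C_1, degree_X_pow_sub_C (by norm_num)]
    rfl
  rw [← quotPoly_spec] at h1
  have h2 : (parityPoly K r * nodePoly u - revNodePoly u).degree ≤ ((r + 1 : ℕ) : WithBot ℕ) := by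
    refine (degree_sub_le _ _).trans (max_le ?_ ?_)
    · rw [degree_mul, degree_eq_natDegree (nodePoly_monic u).ne_zero, nodePoly_natDegree,
        add_comm, Nat.cast_add]
      gcongr
      unfold parityPoly
      split_ifs
      · simp
      · simp
    · exact (revNodePoly_degree_le u).trans (by exact_mod_cast Nat.le_succ r)
  rw [h1] at h2
  have h3 : ((r + 2 : ℕ) : WithBot ℕ) ≤ ((r + 1 : ℕ) : WithBot ℕ) := by
    refine le_trans ?_ h2
    rw [add_comm, Nat.cast_add]
    gcongr
    rfl
  have : r + 2 ≤ r + 1 := by exact_mod_cast h3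
  omega

/-- The numerator of the generating function of the `δ`s over `revNodePoly u`. -/
noncomputable def deltaNumerator (u : Fin r → K) (ρ z : K) : K[X] :=
  C (z * ρ)⁻¹ * (C ((nodePoly u).coeff 0) * nodePoly u - revNodePoly u) + quotPoly u

/-- The factor `(nodePoly u).coeff 0` is the coefficient of `X ^ r` in `revNodePoly u`, so the terms
of degree `r` cancel. The multiple of `nodePoly u` serves only this purpose: it vanishes at the
nodes and leaves the values there unchanged. -/
theorem deltaNumerator_degree_lt (u : Fin r → K) (ρ z : K) :
    (deltaNumerator u ρ z).degree < r := by
  refine (degree_add_le _ _).trans_lt (max_lt ?_ (quotPoly_degree_lt u))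
  rw [degree_lt_iff_coeff_zero]
  intro m hm
  rw [coeff_C_mul, coeff_sub, coeff_C_mul]
  rcases hm.eq_or_lt with rfl | h
  · have := (nodePoly_monic u).coeff_natDegree
    rw [nodePoly_natDegree] at this
    rw [revNodePoly_coeff u le_rfl, this]
    simp
  · rw [revNodePoly_coeff_eq_zero u h,
      coeff_eq_zero_of_natDegree_lt (by rwa [nodePoly_natDegree] : (nodePoly u).natDegree < m)]
    simp

theorem nodePoly_coeff_zero (u : Fin r → K) :
    (nodePoly u).coeff 0 = (-1) ^ r * ∏ i, u i := by
  rw [coeff_zero_eq_eval_zero, nodePoly_eval]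
  simp [prod_neg]

/-- The weights `γ_j` attached to the nodes `u`. -/
noncomputable def nodeWeight (u : Fin r → K) (ρ z : K) (j : Fin r) : K :=
  (∏ l ∈ univ.erase j, (u l * u j - 1) / (u j - u l)) *
    ((1 - u j ^ 2) / (ρ * -z) * ∏ l ∈ univ.erase j, u l + if Odd r then 1 else -u j)

/-- The nodes are non-zero and distinct, and no product of two of them is `1`. -/
structure GenericNodes (u : Fin r → K) : Prop where
  ne_zero : ∀ i, u i ≠ 0
  injective : Function.Injective u
  mul_ne_one : ∀ i j, u i * u j ≠ 1

theorem GenericNodes.sq_sub_one_ne {u : Fin r → K} (hu : GenericNodes u) (i : Fin r) :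
    u i ^ 2 - 1 ≠ 0 := by
  rw [pow_two]; exact sub_ne_zero.mpr (hu.mul_ne_one i i)

theorem GenericNodes.one_sub_ne {u : Fin r → K} (hu : GenericNodes u) (i j : Fin r) :
    1 - u i * u j ≠ 0 := sub_ne_zero.mpr (hu.mul_ne_one i j).symm

/-- The numerator over `revNodePoly u` of the sum of the fractions `γ j / (1 - u j * X)`. -/
noncomputable def fractionNumerator (u γ : Fin r → K) : K[X] :=
  ∑ j, C (γ j) * ∏ l ∈ univ.erase j, (1 - C (u l) * X)

theorem fractionNumerator_degree_lt (u γ : Fin r → K) :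
    (fractionNumerator u γ).degree < r := by
  refine mem_degreeLT.mp (sum_mem fun j _ => mem_degreeLT.mpr ?_)
  rw [← smul_eq_C_mul]
  refine (degree_smul_le _ _).trans_lt ?_
  have h1 : (∏ l ∈ univ.erase j, (1 - C (u l) * X)).degree ≤ ((r - 1 : ℕ) : WithBot ℕ) := by
    refine (degree_prod_le _ _).trans ?_
    have : ∑ l ∈ univ.erase j, (1 - C (u l) * X : K[X]).degree ≤ ∑ l ∈ univ.erase j, 1 := by
      refine sum_le_sum fun l _ => (degree_sub_le _ _).trans (max_le ?_ (degree_C_mul_X_le _))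
      simp
    refine this.trans ?_
    simp
  exact h1.trans_lt (by have := j.pos; exact_mod_cast Nat.sub_lt this one_pos)

theorem fractionNumerator_eval_inv {u : Fin r → K} (γ : Fin r → K) {j : Fin r} (hj : u j ≠ 0) :
    (fractionNumerator u γ).eval (u j)⁻¹ =
      γ j * ∏ l ∈ univ.erase j, (1 - u l * (u j)⁻¹) := by
  rw [fractionNumerator, eval_finsetSum, sum_eq_single j]
  · simp [eval_prod]
  · intro k _ hk
    rw [eval_mul, eval_prod,
      prod_eq_zero (mem_erase.mpr ⟨hk.symm, mem_univ j⟩) (by simp [hj]), mul_zero]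
  · simp

theorem fractionNumerator_eval {u : Fin r → K} (γ : Fin r → K) {x : K}
    (hx : ∀ j, 1 - u j * x ≠ 0) :
    (fractionNumerator u γ).eval x =
      (revNodePoly u).eval x * ∑ j, γ j / (1 - u j * x) := by
  rw [fractionNumerator, eval_finsetSum, mul_sum]
  refine sum_congr rfl fun j _ => ?_
  rw [revNodePoly_eval, ← mul_prod_erase univ _ (mem_univ j)]
  have := hx j
  simp only [eval_mul, eval_C, eval_prod, eval_sub, eval_one, eval_X]
  rw [mul_div_assoc', eq_div_iff this]
  ring

theorem injective_inv {u : Fin r → K} (hu : GenericNodes u) :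
    Function.Injective fun i => (u i)⁻¹ :=
  fun _ _ h => hu.injective (inv_injective h)

/-- Both sides have degree less than `r`, so it suffices to compare them at the distinct points `(u
j)⁻¹`. There `revNodePoly u` vanishes and one summand survives on the left. The value of
`parityPoly` accounts for the two cases in the weight. -/
theorem fractionNumerator_nodeWeight {u : Fin r → K} (hu : GenericNodes u) {ρ z : K}
    (hρ : ρ ≠ 0) (hz : z ≠ 0) :
    fractionNumerator u (nodeWeight u ρ z) = deltaNumerator u ρ z := by
  refine Polynomial.eq_of_degrees_lt_of_eval_index_eq (s := univ) (v := fun i => (u i)⁻¹)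
    (injective_inv hu).injOn (by simpa using fractionNumerator_degree_lt u _)
    (by simpa using deltaNumerator_degree_lt u ρ z) fun j _ => ?_
  have h0 := hu.ne_zero j
  have h2 := hu.sq_sub_one_ne j
  have hrev : (revNodePoly u).eval (u j)⁻¹ = 0 := by
    rw [revNodePoly_eval]
    exact prod_eq_zero (mem_univ j) (by simp [h0])
  have hq := congrArg (eval (u j)⁻¹) (quotPoly_spec u)
  simp only [eval_sub, eval_mul, eval_pow, eval_X, eval_one, hrev, sub_zero] at hq
  have hcard : #(univ.erase j) = r - 1 := by simp
  have hr : r = (r - 1) + 1 := by have := j.pos; omega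
  have hprodu : ∏ i, u i = u j * ∏ l ∈ univ.erase j, u l := (mul_prod_erase univ _ (mem_univ j)).symm
  have hnode : (nodePoly u).eval (u j)⁻¹ =
      (1 - u j ^ 2) * (-1) ^ (r - 1) * (∏ l ∈ univ.erase j, (u l * u j - 1)) * ((u j)⁻¹) ^ r := by
    rw [nodePoly_eval, ← mul_prod_erase univ _ (mem_univ j)]
    have : ∏ l ∈ univ.erase j, ((u j)⁻¹ - u l) =
        ∏ l ∈ univ.erase j, ((-1) * (u l * u j - 1) * (u j)⁻¹) :=
      prod_congr rfl fun l _ => by field_simp; ring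
    rw [this, prod_mul_distrib, prod_mul_distrib, prod_const, prod_const, hcard]
    have hpow : ((u j)⁻¹) ^ r = ((u j)⁻¹) ^ (r - 1) * (u j)⁻¹ := by rw [← pow_succ, ← hr]
    rw [hpow]
    field_simp
  have hleft : ∏ l ∈ univ.erase j, (1 - u l * (u j)⁻¹) =
      (∏ l ∈ univ.erase j, (u j - u l)) * ((u j)⁻¹) ^ (r - 1) := by
    rw [← hcard, ← prod_const, ← prod_mul_distrib]
    exact prod_congr rfl fun l _ => by field_simp
  have hne : ∏ l ∈ univ.erase j, (u j - u l) ≠ 0 :=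
    prod_ne_zero_iff.mpr fun l hl => sub_ne_zero.mpr
      (hu.injective.ne (ne_of_mem_erase hl).symm)
  have hquot : (quotPoly u).eval (u j)⁻¹ =
      (parityPoly K r).eval (u j)⁻¹ * (nodePoly u).eval (u j)⁻¹ * u j ^ 2 / (1 - u j ^ 2) := by
    rw [hq]
    have h3 : 1 - u j ^ 2 ≠ 0 := by rw [← neg_ne_zero]; simpa using h2
    field_simp
  have h3 : 1 - u j ^ 2 ≠ 0 := by rw [← neg_ne_zero]; simpa using h2
  rw [fractionNumerator_eval_inv _ h0, hleft, deltaNumerator]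
  simp only [eval_add, eval_mul, eval_C, eval_sub, hrev, sub_zero, hquot]
  rw [hnode, nodePoly_coeff_zero, hprodu, nodeWeight, prod_div_distrib]
  generalize (∏ l ∈ univ.erase j, (u l * u j - 1)) = A
  generalize ∏ l ∈ univ.erase j, u l = B at *
  generalize ∏ l ∈ univ.erase j, (u j - u l) = D at *
  unfold parityPoly
  split_ifs with h
  · obtain ⟨k, rfl⟩ := h
    simp only [Nat.add_sub_cancel, pow_succ, pow_mul, neg_one_sq, one_pow, eval_X]
    field_simp
  · obtain ⟨k, hk⟩ := Nat.not_odd_iff_even.mp h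
    obtain ⟨m, rfl⟩ : ∃ m, k = m + 1 := ⟨k - 1, by omega⟩
    obtain rfl : r = 2 * m + 1 + 1 := by omega
    simp only [Nat.add_sub_cancel, pow_succ, pow_mul, eval_one]
    field_simp
    ring

/-- The linear system which characterises the weights. -/
def CauchySystem (u : Fin r → K) (ρ z : K) (γ : Fin r → K) : Prop :=
  ∀ i, ρ⁻¹ + z / (u i ^ 2 - 1) + z * ∑ j, γ j / (1 - u j * u i) = 0

theorem deltaNumerator_eval_node {u : Fin r → K} (hu : GenericNodes u) {ρ z : K}
    (hρ : ρ ≠ 0) (hz : z ≠ 0) (i : Fin r) :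
    z * (deltaNumerator u ρ z).eval (u i) =
      (revNodePoly u).eval (u i) * (-ρ⁻¹ - z / (u i ^ 2 - 1)) := by
  have hq := congrArg (eval (u i)) (quotPoly_spec u)
  have h2 := hu.sq_sub_one_ne i
  simp only [eval_sub, eval_mul, eval_pow, eval_X, eval_one, nodePoly_eval_self] at hq
  have hq' : (quotPoly u).eval (u i) = -(revNodePoly u).eval (u i) / (u i ^ 2 - 1) := by
    rw [eq_div_iff h2]; linear_combination -hq
  rw [deltaNumerator]
  simp only [eval_add, eval_mul, eval_C, eval_sub, hq', nodePoly_eval_self]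
  field_simp
  ring

/-- Multiplied by the non-zero value of `revNodePoly u` at `u i`, the `i`-th equation compares the
two numerators at `u i`. Polynomials of degree less than `r` are determined by their values at the
`r` distinct nodes. -/
theorem cauchySystem_iff {u : Fin r → K} (hu : GenericNodes u) {ρ z : K}
    (hρ : ρ ≠ 0) (hz : z ≠ 0) (γ : Fin r → K) :
    CauchySystem u ρ z γ ↔ fractionNumerator u γ = deltaNumerator u ρ z := by
  have key (i : Fin r) : (fractionNumerator u γ).eval (u i) = (deltaNumerator u ρ z).eval (u i) ↔
      ρ⁻¹ + z / (u i ^ 2 - 1) + z * ∑ j, γ j / (1 - u j * u i) = 0 := by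
    have hrev : (revNodePoly u).eval (u i) ≠ 0 := by
      rw [revNodePoly_eval]
      exact prod_ne_zero_iff.mpr fun l _ => hu.one_sub_ne l i
    have h1 := deltaNumerator_eval_node hu hρ hz i
    rw [← mul_right_inj' hz, h1, fractionNumerator_eval γ fun j => hu.one_sub_ne j i,
      mul_left_comm, mul_right_inj' hrev]
    constructor <;> intro h <;> linear_combination h
  constructor
  · intro h
    exact Polynomial.eq_of_degrees_lt_of_eval_index_eq (s := univ) (v := u)
      hu.injective.injOn (by simpa using fractionNumerator_degree_lt u _)
      (by simpa using deltaNumerator_degree_lt u ρ z) fun i _ => (key i).mpr (h i)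
  · intro h i
    exact (key i).mp (by rw [h])

theorem fractionNumerator_injective {u : Fin r → K} (hu : GenericNodes u) :
    Function.Injective (fractionNumerator u) := by
  intro γ γ' h
  funext j
  have h1 := congrArg (eval (u j)⁻¹) h
  rw [fractionNumerator_eval_inv _ (hu.ne_zero j), fractionNumerator_eval_inv _ (hu.ne_zero j)]
    at h1
  refine mul_right_cancel₀ (prod_ne_zero_iff.mpr fun l hl => ?_) h1
  have h0 := hu.ne_zero j
  have : u j - u l ≠ 0 := sub_ne_zero.mpr (hu.injective.ne (ne_of_mem_erase hl).symm)
  intro h2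
  apply this
  field_simp at h2
  simpa using h2

theorem cauchySystem_iff_eq_nodeWeight {u : Fin r → K} (hu : GenericNodes u) {ρ z : K}
    (hρ : ρ ≠ 0) (hz : z ≠ 0) (γ : Fin r → K) :
    CauchySystem u ρ z γ ↔ γ = nodeWeight u ρ z := by
  rw [cauchySystem_iff hu hρ hz, ← fractionNumerator_nodeWeight hu hρ hz]
  exact (fractionNumerator_injective hu).eq_iff

/-- The generating function of `δ` is `deltaNumerator / revNodePoly` exactly when `δ` is the
sequence of power sums of the nodes with the weights `nodeWeight`. -/
theorem mk_mul_revNodePoly_iff {u : Fin r → K} (hu : GenericNodes u) {ρ z : K}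
    (hρ : ρ ≠ 0) (hz : z ≠ 0) (δ : ℕ → K) :
    PowerSeries.mk δ * (revNodePoly u : PowerSeries K) = (deltaNumerator u ρ z : PowerSeries K) ↔
      ∀ k, δ k = ∑ j, nodeWeight u ρ z j * u j ^ k := by
  have hgeom (x : K) : PowerSeries.mk (fun k => x ^ k) * (1 - PowerSeries.C x * PowerSeries.X) =
      1 := by
    ext k
    cases k with
    | zero => simp [mul_sub]
    | succ k =>
      rw [mul_sub, mul_one, mul_left_comm, map_sub, PowerSeries.coeff_C_mul,
        PowerSeries.coeff_succ_mul_X]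
      simp [pow_succ', PowerSeries.coeff_one]
  have hcoe (s : Finset (Fin r)) : ((∏ l ∈ s, (1 - C (u l) * X) : K[X]) : PowerSeries K) =
      ∏ l ∈ s, (1 - PowerSeries.C (u l) * PowerSeries.X) := by
    rw [← Polynomial.coeToPowerSeries.ringHom_apply, map_prod]
    simp
  have h : PowerSeries.mk (fun k => ∑ j, nodeWeight u ρ z j * u j ^ k) *
      (revNodePoly u : PowerSeries K) = (deltaNumerator u ρ z : PowerSeries K) := by
    rw [← fractionNumerator_nodeWeight hu hρ hz]
    have h1 : PowerSeries.mk (fun k => ∑ j, nodeWeight u ρ z j * u j ^ k) =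
        ∑ j, PowerSeries.C (nodeWeight u ρ z j) * PowerSeries.mk (fun k => u j ^ k) := by
      ext k
      simp
    rw [h1, sum_mul, fractionNumerator, ← Polynomial.coeToPowerSeries.ringHom_apply (φ :=
      ∑ j, _), map_sum]
    refine sum_congr rfl fun j _ => ?_
    rw [Polynomial.coeToPowerSeries.ringHom_apply, Polynomial.coe_mul, Polynomial.coe_C, hcoe,
      revNodePoly, hcoe, ← mul_prod_erase univ _ (mem_univ j), mul_assoc, ← mul_assoc _ _
      (∏ l ∈ univ.erase j, _), hgeom, one_mul]
  rw [← h]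
  have hne : (revNodePoly u : PowerSeries K) ≠ 0 := by
    intro h0
    have := congrArg (PowerSeries.coeff 0) h0
    rw [Polynomial.coeff_coe, revNodePoly_coeff u (Nat.zero_le _), Nat.sub_zero] at this
    have h2 := (nodePoly_monic u).coeff_natDegree
    rw [nodePoly_natDegree, this] at h2
    simp at h2
  rw [mul_left_inj' hne]
  constructor
  · intro h2 k
    simpa using congrArg (PowerSeries.coeff k) h2
  · intro h2
    congr 1
    exact funext h2

end Nodes

/-! ### Coefficients of the generating function and the Wilcox–Yu relations. -/

section Coefficients

open Polynomial Finset

variable {K : Type*} [Field K] {r : ℕ}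

/-- As power series, `Q = -N * (1 + X ^ 2 + X ^ 4 + ⋯)`. -/
theorem coeff_of_eq_X_sq_sub_one_mul {N Q : K[X]} (h : N = (X ^ 2 - 1) * Q) (m : ℕ) :
    Q.coeff m = -∑ k ∈ range (m / 2 + 1), N.coeff (m - 2 * k) := by
  have h' : N = Q * X ^ 2 - Q := by rw [h]; ring
  induction m using Nat.strong_induction_on with
  | _ m ih =>
    rw [sum_range_succ']
    have h0 : N.coeff (m - 2 * 0) = (if 2 ≤ m then Q.coeff (m - 2) else 0) - Q.coeff m := by
      rw [mul_zero, Nat.sub_zero, h', coeff_sub, coeff_mul_X_pow']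
    rw [h0]
    split_ifs with hm
    · have h1 : m / 2 = (m - 2) / 2 + 1 := by omega
      have h2 : ∑ k ∈ range (m / 2), N.coeff (m - 2 * (k + 1)) =
          ∑ k ∈ range ((m - 2) / 2 + 1), N.coeff (m - 2 - 2 * k) := by
        rw [h1]
        exact sum_congr rfl fun k _ => by congr 1; omega
      rw [h2]
      linear_combination ih (m - 2) (by omega)
    · have : m / 2 = 0 := by omega
      simp [this]

/-- Indices with `l < j ≤ V` occur in both sums and cancel. This is the origin of the maximum and
the minimum in the bounds of the Wilcox–Yu relations. -/
theorem sum_Icc_sub_sum_Icc_eq (f : ℕ → K) {l L U V : ℕ} (hL : L ≤ l + 1) (hU : V ≤ U) :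
    ∑ j ∈ Icc (l + 1) U, f j - ∑ j ∈ Icc L V, f j =
      ∑ j ∈ Icc (max (l + 1) (V + 1)) U, f j - ∑ j ∈ Icc L (min l V), f j := by
  rcases le_total V l with h | h
  · rw [min_eq_right h, max_eq_left (by omega)]
  · rw [min_eq_left h, max_eq_right (by omega)]
    simp only [← Ico_add_one_right_eq_Icc]
    rw [← sum_Ico_consecutive f (show l + 1 ≤ V + 1 by omega) (show V + 1 ≤ U + 1 by omega),
      ← sum_Ico_consecutive f hL (show l + 1 ≤ V + 1 by omega)]
    ring

theorem sum_parityPoly_mul_coeff (p : K[X]) {l : ℕ} (hl : 1 ≤ l) (hlr : l ≤ r) :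
    ∑ k ∈ range ((r - l) / 2 + 1), (parityPoly K r * p).coeff (r - l - 2 * k) =
      ∑ j ∈ Icc ((l + 1) / 2) ((r + 1) / 2 - 1), p.coeff (2 * j - l) +
        if Odd r then 0 else p.coeff (r - l) := by
  unfold parityPoly
  split_ifs with h
  · obtain ⟨s, rfl⟩ := h
    rw [add_zero]
    -- When `r - l` is even, the last summand is the constant coefficient of `X * p`, which is zero
    -- and can be dropped.
    have h1 : ∑ k ∈ range ((2 * s + 1 - l) / 2 + 1), (X * p).coeff (2 * s + 1 - l - 2 * k) =
        ∑ k ∈ range ((2 * s + 1 - l + 1) / 2), (X * p).coeff (2 * s + 1 - l - 2 * k) := by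
      rcases Nat.even_or_odd' (2 * s + 1 - l) with ⟨t, ht | ht⟩
      · rw [ht, show 2 * t / 2 = t by omega, show (2 * t + 1) / 2 = t by omega, sum_range_succ]
        simp
      · rw [ht, show (2 * t + 1) / 2 = t by omega, show (2 * t + 1 + 1) / 2 = t + 1 by omega]
    rw [h1]
    refine sum_nbij' (fun k => s - k) (fun j => s - j) ?_ ?_ ?_ ?_ ?_
    · intro k hk; simp only [mem_range, mem_Icc] at *; omega
    · intro k hk; simp only [mem_range, mem_Icc] at *; omega
    · intro k hk; simp only [mem_range] at *; omega
    · intro k hk; simp only [mem_Icc] at *; omega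
    · intro k hk
      simp only [mem_range] at hk
      rw [show 2 * s + 1 - l - 2 * k = (2 * (s - k) - l) + 1 by omega, coeff_X_mul]
  · obtain ⟨s, hs⟩ := Nat.not_odd_iff_even.mp h
    -- For even `r = 2 * s` the summand `k = 0` has index `r - l` and is set apart; the others are
    -- reindexed by `j = s - k`.
    rw [sum_range_succ', mul_zero, Nat.sub_zero, one_mul]
    congr 1
    refine sum_nbij' (fun k => s - 1 - k) (fun j => s - 1 - j) ?_ ?_ ?_ ?_ ?_
    · intro k hk; simp only [mem_range, mem_Icc] at *; omega
    · intro k hk; simp only [mem_range, mem_Icc] at *; omega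
    · intro k hk; simp only [mem_range] at *; omega
    · intro k hk; simp only [mem_Icc] at *; omega
    · intro k hk
      simp only [mem_range] at hk
      congr 1
      omega

theorem sum_revNodePoly_coeff (u : Fin r → K) {l : ℕ} (hlr : l ≤ r) :
    ∑ k ∈ range ((r - l) / 2 + 1), (revNodePoly u).coeff (r - l - 2 * k) =
      (nodePoly u).coeff l + ∑ j ∈ Icc (l + 1) ((l + r) / 2), (nodePoly u).coeff (2 * j - l) := by
  rw [sum_range_succ', add_comm, mul_zero, Nat.sub_zero, revNodePoly_coeff u (Nat.sub_le r l),
    Nat.sub_sub_self hlr]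
  congr 1
  refine sum_nbij' (fun k => l + 1 + k) (fun j => j - (l + 1)) ?_ ?_ ?_ ?_ ?_
  · intro k hk; simp only [mem_range, mem_Icc] at *; omega
  · intro k hk; simp only [mem_range, mem_Icc] at *; omega
  · intro k hk; simp only [mem_range] at *; omega
  · intro k hk; simp only [mem_Icc] at *; omega
  · intro k hk
    simp only [mem_range] at hk
    rw [revNodePoly_coeff u (by omega)]
    congr 1
    omega

theorem quotPoly_coeff (u : Fin r → K) {l : ℕ} (hl : 1 ≤ l) (hlr : l ≤ r) :
    (quotPoly u).coeff (r - l) =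
      (nodePoly u).coeff l +
        (∑ j ∈ Icc (max (l + 1) ((r + 1) / 2)) ((l + r) / 2), (nodePoly u).coeff (2 * j - l)
          - ∑ j ∈ Icc ((l + 1) / 2) (min l ((r + 1) / 2 - 1)), (nodePoly u).coeff (2 * j - l)) -
        if Odd r then 0 else (nodePoly u).coeff (r - l) := by
  rw [coeff_of_eq_X_sq_sub_one_mul (quotPoly_spec u)]
  simp only [coeff_sub, sum_sub_distrib]
  rw [sum_parityPoly_mul_coeff _ hl hlr, sum_revNodePoly_coeff u hlr]
  have h := sum_Icc_sub_sum_Icc_eq (fun j => (nodePoly u).coeff (2 * j - l))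
    (l := l) (L := (l + 1) / 2) (U := (l + r) / 2) (V := (r + 1) / 2 - 1)
    (by omega) (by omega)
  rw [show (r + 1) / 2 - 1 + 1 = (r + 1) / 2 by omega] at h
  linear_combination h

theorem coeff_mk_mul_revNodePoly_of_le (u : Fin r → K) (δ : ℕ → K) {l : ℕ} (hlr : l ≤ r) :
    PowerSeries.coeff (r - l) (PowerSeries.mk δ * (revNodePoly u : PowerSeries K)) =
      (nodePoly u).coeff l * δ 0 +
        ∑ j ∈ Icc 1 (r - l), (nodePoly u).coeff (j + l) * δ j := by
  rw [PowerSeries.coeff_mul, Nat.sum_antidiagonal_eq_sum_range_succ_mk, sum_range_succ', add_comm,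
    ← Ico_add_one_right_eq_Icc, sum_Ico_eq_sum_range, Nat.add_sub_cancel]
  have key (k : ℕ) (hk : k ≤ r - l) : PowerSeries.coeff k (PowerSeries.mk δ) *
      PowerSeries.coeff (r - l - k) (revNodePoly u : PowerSeries K) =
      (nodePoly u).coeff (k + l) * δ k := by
    rw [PowerSeries.coeff_mk, Polynomial.coeff_coe, revNodePoly_coeff u (by omega), mul_comm]
    congr 2
    omega
  congr 1
  · simpa using key 0 (Nat.zero_le _)
  · refine sum_congr rfl fun k hk => ?_
    rw [key _ (by have := mem_range.mp hk; omega), add_comm k 1]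

theorem coeff_mk_mul_revNodePoly_of_ge (u : Fin r → K) (δ : ℕ → K) {b : ℕ} (hb : r ≤ b) :
    PowerSeries.coeff b (PowerSeries.mk δ * (revNodePoly u : PowerSeries K)) =
      δ b + ∑ j ∈ range r, (nodePoly u).coeff j * δ (b - r + j) := by
  have h1 := (nodePoly_monic u).coeff_natDegree
  rw [nodePoly_natDegree] at h1
  have h2 : δ b = (nodePoly u).coeff r * δ (b - r + r) := by
    rw [h1, one_mul, Nat.sub_add_cancel hb]
  rw [h2, add_comm, ← sum_range_succ (fun j => (nodePoly u).coeff j * δ (b - r + j)), mul_comm,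
    PowerSeries.coeff_mul, Nat.sum_antidiagonal_eq_sum_range_succ_mk]
  have h3 : range (r + 1) ⊆ range (b.succ) := range_mono (by omega)
  rw [← sum_subset h3]
  · rw [← sum_range_reflect]
    refine sum_congr rfl fun k hk => ?_
    have := mem_range.mp hk
    rw [PowerSeries.coeff_mk, Polynomial.coeff_coe, revNodePoly_coeff u (by omega)]
    rw [show r - (r + 1 - 1 - k) = k by omega, show b - (r + 1 - 1 - k) = b - r + k by omega]
  · intro k _ hk
    rw [Polynomial.coeff_coe, revNodePoly_coeff_eq_zero u (by simpa using hk), zero_mul]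

/-- The generating function identity for `δ`, in terms of coefficients. -/
theorem mk_mul_revNodePoly_iff_coeff {u : Fin r → K} (hu : ∀ i, u i ≠ 0) (hr : 0 < r) {ρ z : K}
    (hρ : ρ ≠ 0) (hz : z ≠ 0) (δ : ℕ → K) (hδ : ρ⁻¹ - ρ = -z * (δ 0 - 1)) :
    PowerSeries.mk δ * (revNodePoly u : PowerSeries K) = (deltaNumerator u ρ z : PowerSeries K) ↔
      (∀ l ∈ Icc 1 (r - 1),
        ρ * ((nodePoly u).coeff l - (nodePoly u).coeff (r - l) * ((nodePoly u).coeff 0)⁻¹) +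
          z * (∑ j ∈ Icc 1 (r - l), (nodePoly u).coeff (j + l) * δ j
            - ∑ j ∈ Icc (max (l + 1) ((r + 1) / 2)) ((l + r) / 2), (nodePoly u).coeff (2 * j - l)
            + ∑ j ∈ Icc ((l + 1) / 2) (min l ((r + 1) / 2 - 1)),
                (nodePoly u).coeff (2 * j - l)) = 0) ∧
      ρ⁻¹ * (nodePoly u).coeff 0 - ρ * ((nodePoly u).coeff 0)⁻¹ = (if Odd r then 0 else z) ∧
      ∀ b, r ≤ b → δ b = -∑ j ∈ range r, (nodePoly u).coeff j * δ (b - r + j) := by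
  have ha : (nodePoly u).coeff 0 ≠ 0 := by
    rw [nodePoly_coeff_zero]
    exact mul_ne_zero (pow_ne_zero _ (by simp)) (prod_ne_zero_iff.mpr fun i _ => hu i)
  have hinv := mul_inv_cancel₀ ha
  have har : (nodePoly u).coeff r = 1 := by
    have h1 := (nodePoly_monic u).coeff_natDegree
    rwa [nodePoly_natDegree] at h1
  have hnum (l : ℕ) (hl : l ≤ r) : z * (deltaNumerator u ρ z).coeff (r - l) =
      ρ⁻¹ * ((nodePoly u).coeff 0 * (nodePoly u).coeff (r - l) - (nodePoly u).coeff l) +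
        z * (quotPoly u).coeff (r - l) := by
    rw [deltaNumerator, coeff_add, coeff_C_mul, coeff_sub, coeff_C_mul,
      revNodePoly_coeff u (Nat.sub_le r l), Nat.sub_sub_self hl]
    field_simp
  have hzero : PowerSeries.coeff 0 (PowerSeries.mk δ * (revNodePoly u : PowerSeries K)) =
        (deltaNumerator u ρ z).coeff 0 ↔
      ρ⁻¹ * (nodePoly u).coeff 0 - ρ * ((nodePoly u).coeff 0)⁻¹ = (if Odd r then 0 else z) := by
    have h1 := coeff_mk_mul_revNodePoly_of_le u δ (le_refl r)
    have h2 := quotPoly_coeff u hr le_rfl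
    have h3 := hnum r le_rfl
    have e1 : Icc (max (r + 1) ((r + 1) / 2)) ((r + r) / 2) = ∅ := Icc_eq_empty (by omega)
    have e2 : Icc ((r + 1) / 2) (min r ((r + 1) / 2 - 1)) = ∅ := Icc_eq_empty (by omega)
    rw [e1, e2] at h2
    simp only [Nat.sub_self, har, sum_empty, sub_zero, add_zero] at h1 h2 h3
    simp only [zero_lt_one, Icc_eq_empty_of_lt, sum_empty, add_zero, one_mul] at h1
    rw [h1, ← mul_right_inj' hz, h3, h2, ← mul_right_inj' (b := _ - _) ha]
    split_ifs <;> constructor <;> intro h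
    · linear_combination -h + hδ - ρ * hinv
    · linear_combination -h + hδ - ρ * hinv
    · linear_combination -h + hδ - ρ * hinv
    · linear_combination -h + hδ - ρ * hinv
  -- The equivalence presupposes the relation from the constant coefficient: it trades `ρ⁻¹ * a₀`
  -- for `ρ * a₀⁻¹` in front of `a_{r-l}`, and `hδ` eliminates `δ 0`.
  have hlow (h : ρ⁻¹ * (nodePoly u).coeff 0 - ρ * ((nodePoly u).coeff 0)⁻¹ =
      (if Odd r then 0 else z)) (l : ℕ) (hl : 1 ≤ l) (hlr : l ≤ r) :
      PowerSeries.coeff (r - l) (PowerSeries.mk δ * (revNodePoly u : PowerSeries K)) =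
        (deltaNumerator u ρ z).coeff (r - l) ↔
      ρ * ((nodePoly u).coeff l - (nodePoly u).coeff (r - l) * ((nodePoly u).coeff 0)⁻¹) +
        z * (∑ j ∈ Icc 1 (r - l), (nodePoly u).coeff (j + l) * δ j
          - ∑ j ∈ Icc (max (l + 1) ((r + 1) / 2)) ((l + r) / 2), (nodePoly u).coeff (2 * j - l)
          + ∑ j ∈ Icc ((l + 1) / 2) (min l ((r + 1) / 2 - 1)),
              (nodePoly u).coeff (2 * j - l)) = 0 := by
    rw [coeff_mk_mul_revNodePoly_of_le u δ hlr, ← mul_right_inj' hz, hnum l hlr,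
      quotPoly_coeff u hl hlr]
    generalize ∑ j ∈ Icc 1 (r - l), (nodePoly u).coeff (j + l) * δ j = A
    generalize ∑ j ∈ Icc _ ((l + r) / 2), (nodePoly u).coeff (2 * j - l) = B
    generalize ∑ j ∈ Icc ((l + 1) / 2) _, (nodePoly u).coeff (2 * j - l) = D
    split_ifs at h ⊢ <;> constructor <;> intro h'
    · linear_combination h' - (nodePoly u).coeff l * hδ + (nodePoly u).coeff (r - l) * h
    · linear_combination h' + (nodePoly u).coeff l * hδ - (nodePoly u).coeff (r - l) * h
    · linear_combination h' - (nodePoly u).coeff l * hδ + (nodePoly u).coeff (r - l) * h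
    · linear_combination h' + (nodePoly u).coeff l * hδ - (nodePoly u).coeff (r - l) * h
  have hhigh (b : ℕ) (hb : r ≤ b) :
      PowerSeries.coeff b (PowerSeries.mk δ * (revNodePoly u : PowerSeries K)) =
        (deltaNumerator u ρ z).coeff b ↔
      δ b = -∑ j ∈ range r, (nodePoly u).coeff j * δ (b - r + j) := by
    rw [coeff_mk_mul_revNodePoly_of_ge u δ hb, eq_neg_iff_add_eq_zero,
      (degree_lt_iff_coeff_zero _ _).mp (deltaNumerator_degree_lt u ρ z) b hb]
  constructor
  · intro h
    have h' (m : ℕ) : PowerSeries.coeff m (PowerSeries.mk δ * (revNodePoly u : PowerSeries K)) =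
        (deltaNumerator u ρ z).coeff m := by rw [h, Polynomial.coeff_coe]
    have h2 := hzero.mp (h' 0)
    refine ⟨fun l hl => ?_, h2, fun b hb => (hhigh b hb).mp (h' b)⟩
    rw [mem_Icc] at hl
    exact (hlow h2 l hl.1 (by omega)).mp (h' _)
  · rintro ⟨h1, h2, h3⟩
    ext m
    rw [Polynomial.coeff_coe]
    rcases Nat.eq_zero_or_pos m with rfl | hm
    · exact hzero.mpr h2
    rcases le_or_gt r m with hrm | hrm
    · exact (hhigh m hrm).mpr (h3 m hrm)
    · have := (hlow h2 (r - m) (by omega) (by omega)).mpr (h1 _ (mem_Icc.mpr (by omega)))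
      rwa [Nat.sub_sub_self hrm.le] at this

end Coefficients

/-! ### The operators `y`, `e`, `g` on the vectors of values at the nodes. -/

section Operators

open Finset

variable {K : Type*} [Field K] {r : ℕ}

/-- The weighted sum of the coordinates. -/
def pairing (γ : Fin r → K) : (Fin r → K) →ₗ[K] K where
  toFun f := ∑ j, γ j * f j
  map_add' f g := by simp [mul_add, sum_add_distrib]
  map_smul' c f := by simp [mul_sum, mul_left_comm]

/-- The action of `e`: the pairing with `γ`, times the constant vector `1`. -/
def eOp (γ : Fin r → K) : (Fin r → K) →ₗ[K] (Fin r → K) :=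
  LinearMap.pi fun _ => pairing γ

/-- The diagonal operator with the entries `d`. -/
def diagOp (d : Fin r → K) : (Fin r → K) →ₗ[K] (Fin r → K) where
  toFun f := d * f
  map_add' f g := mul_add d f g
  map_smul' c f := mul_smul_comm c d f

/-- The action of `g` on the vectors of values at the nodes. -/
def gOp (u : Fin r → K) (z : K) (γ : Fin r → K) : (Fin r → K) →ₗ[K] (Fin r → K) where
  toFun f i := -z * (f i / (u i ^ 2 - 1) + ∑ j, γ j * f j / (1 - u j * u i))
  map_add' f g := by
    funext i
    simp only [Pi.add_apply, mul_add, add_div, sum_add_distrib]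
    ring
  map_smul' c f := by
    funext i
    simp only [Pi.smul_apply, smul_eq_mul, mul_add, mul_sum, RingHom.id_apply]
    congr 1
    · ring
    · exact sum_congr rfl fun j _ => by ring

theorem pairing_apply (γ f : Fin r → K) : pairing γ f = ∑ j, γ j * f j := rfl

theorem eOp_apply (γ f : Fin r → K) (i : Fin r) : eOp γ f i = pairing γ f := rfl

theorem diagOp_apply (d f : Fin r → K) (i : Fin r) : diagOp d f i = d i * f i := rfl

theorem gOp_apply (u : Fin r → K) (z : K) (γ f : Fin r → K) (i : Fin r) :
    gOp u z γ f i = -z * (f i / (u i ^ 2 - 1) + ∑ j, γ j * f j / (1 - u j * u i)) := rfl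

theorem eOp_eq_smul (γ f : Fin r → K) : eOp γ f = pairing γ f • (1 : Fin r → K) := by
  funext i
  simp [eOp_apply]

/-- Quadratic identities in `gOp` can thus be checked on the off-diagonal entries and on the vector
`1` alone. The diagonal entries, which contain squared denominators, need not be computed. -/
theorem eq_diagOp_of_offDiagonal {T : (Fin r → K) →ₗ[K] (Fin r → K)}
    (h : ∀ i k, i ≠ k → T (Pi.single k 1) i = 0) : T = diagOp (T 1) := by
  have key (f : Fin r → K) (i : Fin r) : T f i = T (Pi.single i 1) i * f i := by
    have h1 : f = ∑ k, f k • Pi.single k (1 : K) := by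
      funext i
      simp [Finset.sum_apply, Pi.single_apply]
    conv_lhs => rw [h1, map_sum, Finset.sum_apply]
    rw [sum_eq_single i]
    · simp [mul_comm]
    · intro k _ hk
      simp [h i k hk.symm]
    · simp
  ext1 i
  ext k
  simp only [LinearMap.coe_comp, Function.comp_apply, diagOp_apply]
  rw [key, key 1 k]
  simp

theorem gOp_single (u : Fin r → K) (z : K) (γ : Fin r → K) (k i : Fin r) :
    gOp u z γ (Pi.single k 1) i =
      -z * ((if i = k then 1 / (u k ^ 2 - 1) else 0) + γ k / (1 - u k * u i)) := by
  rw [gOp_apply, sum_eq_single k]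
  · by_cases h : i = k
    · subst h; simp
    · simp [h]
  · intro j _ hj
    simp [hj]
  · simp

/-- `gOp` is symmetric for the bilinear form attached to the weights. -/
theorem pairing_mul_gOp (u : Fin r → K) (z : K) (γ a b : Fin r → K) :
    pairing γ (a * gOp u z γ b) = pairing γ (gOp u z γ a * b) := by
  simp only [pairing_apply, Pi.mul_apply, gOp_apply, mul_add, add_mul, sum_add_distrib, mul_sum,
    sum_mul]
  congr 1
  · exact sum_congr rfl fun i _ => by ring
  · rw [sum_comm]
    refine sum_congr rfl fun i _ => sum_congr rfl fun j _ => ?_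
    rw [mul_comm (u i) (u j)]
    ring

variable {u γ : Fin r → K} {ρ z δ₀ : K}

/-- The coordinates of this identity are the equations of the Cauchy system. -/
theorem gOp_one (hC : CauchySystem u ρ z γ) : gOp u z γ 1 = ρ⁻¹ • 1 := by
  funext i
  have := hC i
  simp only [gOp_apply, Pi.one_apply, Pi.smul_apply, smul_eq_mul, mul_one]
  linear_combination -this

theorem pairing_gOp (hC : CauchySystem u ρ z γ) (f : Fin r → K) :
    pairing γ (gOp u z γ f) = ρ⁻¹ * pairing γ f := by
  have := pairing_mul_gOp u z γ 1 f
  rw [one_mul] at this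
  rw [this, gOp_one hC, smul_mul_assoc, one_mul, map_smul, smul_eq_mul]

/-- This is the relation `y g y = g - z (1 - e)` that dictates the form of `gOp`: in matrix entries
it reads `(1 - u i * u k) * g i k = z * ((if i = k then 1 else 0) - γ k)`. The Cauchy system plays
no part in it. -/
theorem mul_gOp_mul (hu : GenericNodes u) (f : Fin r → K) :
    u * gOp u z γ (u * f) = gOp u z γ f - z • (f - eOp γ f) := by
  funext i
  have h2 := hu.sq_sub_one_ne i
  have h1 (j : Fin r) : γ j * (u j * f j) / (1 - u j * u i) * u i =
      γ j * f j / (1 - u j * u i) - γ j * f j := by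
    have := hu.one_sub_ne j i
    field_simp
    ring
  simp only [Pi.mul_apply, Pi.sub_apply, Pi.smul_apply, smul_eq_mul, eOp_apply, pairing_apply,
    gOp_apply]
  have h3 : u i * (-z * (u i * f i / (u i ^ 2 - 1) +
      ∑ j, γ j * (u j * f j) / (1 - u j * u i))) = -z * (u i * (u i * f i / (u i ^ 2 - 1)) +
      ∑ j, γ j * (u j * f j) / (1 - u j * u i) * u i) := by rw [← sum_mul]; ring
  rw [h3]
  simp only [h1, sum_sub_distrib]
  have h4 : u i * (u i * f i / (u i ^ 2 - 1)) = f i / (u i ^ 2 - 1) + f i := by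
    field_simp
    ring
  rw [h4]
  ring

theorem mul_gOp_node (hu : GenericNodes u) (hC : CauchySystem u ρ z γ)
    (h0 : pairing γ 1 = δ₀) (hδ : ρ⁻¹ - ρ = -z * (δ₀ - 1)) :
    u * gOp u z γ u = ρ • 1 := by
  have := mul_gOp_mul (z := z) (γ := γ) hu 1
  rw [mul_one] at this
  rw [this, gOp_one hC, eOp_eq_smul, h0]
  funext i
  simp only [Pi.sub_apply, Pi.smul_apply, smul_eq_mul, Pi.one_apply, mul_one]
  linear_combination hδ

/-- Partial fractions in `u j` reduce the sums in the entries of a product of two copies of `gOp` to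
the sums known from the Cauchy system. -/
theorem sum_div_mul (hu : GenericNodes u) (γ : Fin r → K) {i k : Fin r} (hik : i ≠ k) :
    ∑ j, γ j / ((1 - u k * u j) * (1 - u j * u i)) =
      (u i * ∑ j, γ j / (1 - u j * u i) - u k * ∑ j, γ j / (1 - u j * u k)) / (u i - u k) := by
  have hne : u i - u k ≠ 0 := sub_ne_zero.mpr (hu.injective.ne hik)
  rw [eq_div_iff hne, sum_mul, mul_sum, mul_sum, ← sum_sub_distrib]
  refine sum_congr rfl fun j _ => ?_
  have h1 := hu.one_sub_ne j i
  have h2 := hu.one_sub_ne j k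
  rw [mul_comm (u k) (u j)]
  field_simp
  ring

theorem sum_mul_div_mul (hu : GenericNodes u) (γ : Fin r → K) {i k : Fin r} (hik : i ≠ k) :
    ∑ j, γ j * u j / ((1 - u k * u j) * (1 - u j * u i)) =
      (∑ j, γ j / (1 - u j * u i) - ∑ j, γ j / (1 - u j * u k)) / (u i - u k) := by
  have hne : u i - u k ≠ 0 := sub_ne_zero.mpr (hu.injective.ne hik)
  rw [eq_div_iff hne, sum_mul, ← sum_sub_distrib]
  refine sum_congr rfl fun j _ => ?_
  have h1 := hu.one_sub_ne j i
  have h2 := hu.one_sub_ne j k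
  rw [mul_comm (u k) (u j)]
  field_simp
  ring

theorem gOp_gOp_single (hu : GenericNodes u) (z : K) (γ d : Fin r → K) {i k : Fin r}
    (hik : i ≠ k) :
    gOp u z γ (d * gOp u z γ (Pi.single k 1)) i =
      z ^ 2 * γ k * (d i / ((u i ^ 2 - 1) * (1 - u k * u i)) +
        d k / ((u k ^ 2 - 1) * (1 - u k * u i)) +
        ∑ j, γ j * d j / ((1 - u k * u j) * (1 - u j * u i))) := by
  have h1 (j : Fin r) : γ j * (d * gOp u z γ (Pi.single k 1)) j / (1 - u j * u i) =
      (if j = k then -z * γ k * d k / ((u k ^ 2 - 1) * (1 - u k * u i)) else 0) +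
        -z * γ k * (γ j * d j / ((1 - u k * u j) * (1 - u j * u i))) := by
    have := hu.one_sub_ne j i
    have := hu.one_sub_ne k j
    have := hu.sq_sub_one_ne k
    rw [Pi.mul_apply, gOp_single]
    split_ifs with h
    · subst h
      field_simp
      ring
    · field_simp
      ring
  rw [gOp_apply]
  simp only [h1, sum_add_distrib, sum_ite_eq', mem_univ, if_true, ← mul_sum]
  rw [Pi.mul_apply, gOp_single, if_neg hik]
  have := hu.one_sub_ne k i
  have := hu.sq_sub_one_ne k
  have := hu.sq_sub_one_ne i
  field_simp
  ring

/-- The difference of the two sides kills `1`, by `gOp_one` and the relation between `ρ` and `δ₀`.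
Its entry at `(i, k)`, `i ≠ k`, vanishes by a combination of the `i`-th and `k`-th Cauchy equations.
-/
theorem gOp_comp_gOp (hu : GenericNodes u) (hC : CauchySystem u ρ z γ) (hρ : ρ ≠ 0)
    (h0 : pairing γ 1 = δ₀) (hδ : ρ⁻¹ - ρ = -z * (δ₀ - 1)) :
    gOp u z γ ∘ₗ gOp u z γ = LinearMap.id + z • gOp u z γ - (z * ρ⁻¹) • eOp γ := by
  set T := gOp u z γ ∘ₗ gOp u z γ - (LinearMap.id + z • gOp u z γ - (z * ρ⁻¹) • eOp γ) with hT
  have h1 : T 1 = 0 := by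
    simp only [hT, LinearMap.sub_apply, LinearMap.comp_apply, LinearMap.add_apply,
      LinearMap.smul_apply, LinearMap.id_apply, gOp_one hC, map_smul, eOp_eq_smul, h0]
    funext i
    simp only [Pi.sub_apply, Pi.add_apply, Pi.smul_apply, smul_eq_mul, Pi.one_apply, mul_one,
      Pi.zero_apply]
    linear_combination ρ⁻¹ * hδ + mul_inv_cancel₀ hρ
  have h2 : T = diagOp (T 1) := by
    refine eq_diagOp_of_offDiagonal fun i k hik => ?_
    have hg := gOp_gOp_single hu z γ 1 hik
    rw [one_mul] at hg
    have he : pairing γ (Pi.single k 1) = γ k := by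
      rw [pairing_apply, sum_eq_single k] <;> simp +contextual
    simp only [hT, LinearMap.sub_apply, LinearMap.comp_apply, LinearMap.add_apply,
      LinearMap.smul_apply, LinearMap.id_apply, Pi.sub_apply, Pi.add_apply, Pi.smul_apply,
      smul_eq_mul, hg, gOp_single, eOp_apply, he, if_neg hik, Pi.single_eq_of_ne hik, Pi.one_apply,
      mul_one]
    rw [sum_div_mul hu γ hik]
    have hi := hC i
    have hk := hC k
    have n1 := hu.one_sub_ne k i
    have n2 := hu.sq_sub_one_ne k
    have n3 := hu.sq_sub_one_ne i
    have n4 : u i - u k ≠ 0 := sub_ne_zero.mpr (hu.injective.ne hik)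
    have n5 : 1 - u i * u k ≠ 0 := hu.one_sub_ne i k
    have key : 1 / ((u i ^ 2 - 1) * (1 - u k * u i)) + 1 / ((u k ^ 2 - 1) * (1 - u k * u i)) +
        1 / (1 - u k * u i) = (u i / (u i ^ 2 - 1) - u k / (u k ^ 2 - 1)) / (u i - u k) := by
      field_simp
      ring
    have key2 : z * ((u i * ∑ j, γ j / (1 - u j * u i) - u k * ∑ j, γ j / (1 - u j * u k)) /
        (u i - u k)) = -ρ⁻¹ - z * ((u i / (u i ^ 2 - 1) - u k / (u k ^ 2 - 1)) / (u i - u k)) := by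
      rw [mul_div_assoc', mul_div_assoc', div_eq_iff n4, sub_mul, div_mul_cancel₀ _ n4]
      linear_combination u i * hi - u k * hk
    linear_combination z * γ k * key2 + z ^ 2 * γ k * key
  rw [h1] at h2
  rw [← sub_eq_zero, ← hT, h2]
  ext
  simp [diagOp]

/-- The off-diagonal entries vanish by the difference of two Cauchy equations. The identity makes
both sides of the affine braid relation equal to `1`. -/
theorem gOp_comp_diagOp_comp_gOp (hu : GenericNodes u) (hC : CauchySystem u ρ z γ) (hρ : ρ ≠ 0)
    (h0 : pairing γ 1 = δ₀) (hδ : ρ⁻¹ - ρ = -z * (δ₀ - 1)) :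
    gOp u z γ ∘ₗ diagOp u ∘ₗ gOp u z γ = diagOp u⁻¹ := by
  have h1 : (gOp u z γ ∘ₗ diagOp u ∘ₗ gOp u z γ) 1 = u⁻¹ := by
    have h := mul_gOp_node hu hC h0 hδ
    have h2 : gOp u z γ u = ρ • u⁻¹ := by
      funext i
      have := congrFun h i
      simp only [Pi.mul_apply, Pi.smul_apply, Pi.one_apply, smul_eq_mul, mul_one,
        Pi.inv_apply] at this ⊢
      have h3 := hu.ne_zero i
      field_simp
      linear_combination this
    simp only [LinearMap.comp_apply, gOp_one hC, map_smul]
    have h3 : diagOp u (1 : Fin r → K) = u := mul_one u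
    rw [h3, h2, smul_smul, inv_mul_cancel₀ hρ, one_smul]
  rw [← h1]
  refine eq_diagOp_of_offDiagonal fun i k hik => ?_
  have hg : (gOp u z γ ∘ₗ diagOp u ∘ₗ gOp u z γ) (Pi.single k 1) i = _ :=
    gOp_gOp_single hu z γ u hik
  rw [hg, sum_mul_div_mul hu γ hik]
  have hi := hC i
  have hk := hC k
  have n1 := hu.one_sub_ne k i
  have n2 := hu.sq_sub_one_ne k
  have n3 := hu.sq_sub_one_ne i
  have n4 : u i - u k ≠ 0 := sub_ne_zero.mpr (hu.injective.ne hik)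
  have key : u i / ((u i ^ 2 - 1) * (1 - u k * u i)) + u k / ((u k ^ 2 - 1) * (1 - u k * u i)) =
      (1 / (u i ^ 2 - 1) - 1 / (u k ^ 2 - 1)) / (u i - u k) := by
    have n5 : 1 - u i * u k ≠ 0 := hu.one_sub_ne i k
    field_simp
    ring
  have key2 : z * ((∑ j, γ j / (1 - u j * u i) - ∑ j, γ j / (1 - u j * u k)) /
      (u i - u k)) = -(z * ((1 / (u i ^ 2 - 1) - 1 / (u k ^ 2 - 1)) / (u i - u k))) := by
    rw [mul_div_assoc', mul_div_assoc', ← neg_div, div_left_inj' n4]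
    linear_combination hi - hk
  linear_combination z * γ k * key2 + z ^ 2 * γ k * key

/-- Iterating `mul_gOp_mul` moves `g` past one power of `y` at a time. Paired with `γ`, the formula
becomes the defining recursion of the `δ_{-j}`. -/
theorem gOp_zpow (hu : GenericNodes u) (hC : CauchySystem u ρ z γ)
    (h0 : pairing γ 1 = δ₀) (hδ : ρ⁻¹ - ρ = -z * (δ₀ - 1)) (n : ℕ) :
    gOp u z γ (fun i => u i ^ (n + 1)) = ρ • (fun i => u i ^ (-((n : ℤ) + 1))) -
      z • ∑ k ∈ Icc 1 n, ((fun i => u i ^ (2 * (k : ℤ) - (n + 1))) -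
        pairing γ (fun i => u i ^ k) • fun i => u i ^ ((k : ℤ) - (n + 1))) := by
  induction n with
  | zero =>
    have h := mul_gOp_node hu hC h0 hδ
    funext i
    have h1 := congrFun h i
    have h2 := hu.ne_zero i
    simp only [Pi.mul_apply, Pi.smul_apply, Pi.one_apply, smul_eq_mul, mul_one] at h1
    simp only [zero_add, pow_one]
    simp
    field_simp
    linear_combination h1
  | succ n ih =>
    have h := mul_gOp_mul (z := z) (γ := γ) hu (fun i => u i ^ (n + 1))
    funext i
    have h1 := congrFun h i
    have h2 := hu.ne_zero i
    have h3 : (u * fun i => u i ^ (n + 1)) = fun i => u i ^ (n + 1 + 1) := by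
      funext i
      simp [pow_succ']
    rw [h3, ih] at h1
    rw [sum_Icc_succ_top (by omega)]
    simp only [Pi.mul_apply, Pi.smul_apply, smul_eq_mul, Pi.sub_apply, Finset.sum_apply,
      eOp_apply, Pi.add_apply] at h1 ⊢
    rw [← mul_right_inj' h2, h1]
    have e1 (m : ℤ) : u i ^ (m - ((n : ℤ) + 1)) = u i * u i ^ (m - (((n + 1 : ℕ) : ℤ) + 1)) := by
      rw [← zpow_one_add₀ h2]
      congr 1
      push_cast
      ring
    have e2 : u i ^ (-((n : ℤ) + 1)) = u i * u i ^ (-(((n + 1 : ℕ) : ℤ) + 1)) := by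
      simpa using e1 0
    have e3 : u i * u i ^ (2 * ((n + 1 : ℕ) : ℤ) - (((n + 1 : ℕ) : ℤ) + 1)) = u i ^ (n + 1) := by
      rw [← e1, ← zpow_natCast]
      congr 1
      push_cast
      ring
    have e4 : u i * u i ^ (((n + 1 : ℕ) : ℤ) - (((n + 1 : ℕ) : ℤ) + 1)) = 1 := by
      rw [← e1]
      simp
    simp only [e1, e2]
    have e5 : ∑ k ∈ Icc 1 n, (u i * u i ^ (2 * (k : ℤ) - (((n + 1 : ℕ) : ℤ) + 1)) -
        pairing γ (fun i => u i ^ k) * (u i * u i ^ ((k : ℤ) - (((n + 1 : ℕ) : ℤ) + 1)))) =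
        u i * ∑ k ∈ Icc 1 n, (u i ^ (2 * (k : ℤ) - (((n + 1 : ℕ) : ℤ) + 1)) -
        pairing γ (fun i => u i ^ k) * (u i ^ ((k : ℤ) - (((n + 1 : ℕ) : ℤ) + 1)))) := by
      rw [mul_sum]
      exact sum_congr rfl fun k _ => by ring
    rw [e5]
    linear_combination z * e3 - z * pairing γ (fun i => u i ^ (n + 1)) * e4

/-- The recursion for the power sums with negative exponents. -/
theorem pairing_zpow_neg (hu : GenericNodes u) (hC : CauchySystem u ρ z γ) (hρ : ρ ≠ 0)
    (h0 : pairing γ 1 = δ₀) (hδ : ρ⁻¹ - ρ = -z * (δ₀ - 1)) (n : ℕ) :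
    pairing γ (fun i => u i ^ (-((n : ℤ) + 1))) =
      ρ⁻¹ ^ 2 * pairing γ (fun i => u i ^ (n + 1)) - z * ρ⁻¹ * ∑ k ∈ Icc 1 n,
        (pairing γ (fun i => u i ^ k) * pairing γ (fun i => u i ^ ((k : ℤ) - (n + 1))) -
          pairing γ (fun i => u i ^ (2 * (k : ℤ) - (n + 1)))) := by
  have h1 := congrArg (pairing γ) (gOp_zpow hu hC h0 hδ n)
  rw [pairing_gOp hC] at h1
  simp only [map_sub, map_smul, map_sum, smul_eq_mul] at h1
  have h2 := inv_mul_cancel₀ hρ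
  rw [sum_sub_distrib] at h1 ⊢
  linear_combination -ρ⁻¹ * h1 - pairing γ (fun i => u i ^ (-((n : ℤ) + 1))) * h2

end Operators

/-! ### Passage to the field of fractions: (R) ⇔ (G), and weak admissibility from (G). -/

namespace GroundRingParameters

section FractionField

open Finset

variable {S : Type u} [CommRing S] [IsDomain S] {r : ℕ} (P : GroundRingParameters S r)

/-- The image of `ρ` in the field of fractions. -/
noncomputable def ρFrac : FractionRing S := algebraMap S (FractionRing S) P.ρ

/-- The image of `q - q⁻¹` in the field of fractions. -/
noncomputable def zFrac : FractionRing S := algebraMap S (FractionRing S) P.qDiff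

theorem algebraMap_unit_inv (x : Sˣ) :
    algebraMap S (FractionRing S) (x⁻¹ : Sˣ) = (algebraMap S (FractionRing S) x)⁻¹ := by
  refine eq_inv_of_mul_eq_one_left ?_
  rw [← map_mul, Units.inv_mul, map_one]

theorem algebraMap_unit_ne_zero (x : Sˣ) : algebraMap S (FractionRing S) x ≠ 0 :=
  (x.isUnit.map (algebraMap S (FractionRing S))).ne_zero

theorem ρFrac_ne_zero : P.ρFrac ≠ 0 := algebraMap_unit_ne_zero P.ρ

theorem algebraMap_ρ_inv : algebraMap S (FractionRing S) (P.ρ⁻¹ : Sˣ) = P.ρFrac⁻¹ :=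
  algebraMap_unit_inv P.ρ

theorem zFrac_ne_zero {S : Type u} [CommRing S] {P : GroundRingParameters S r} (h : P.qDiff ≠ 0) : P.zFrac ≠ 0 :=
  (map_ne_zero_iff _ (IsFractionRing.injective S (FractionRing S))).mpr h

theorem relation_frac :
    P.ρFrac⁻¹ - P.ρFrac = -P.zFrac * (algebraMap S (FractionRing S) (P.δ 0) - 1) := by
  have := congrArg (algebraMap S (FractionRing S)) P.relation
  simp only [map_sub, map_mul, map_one, algebraMap_ρ_inv] at this
  rw [← ρFrac] at this
  rw [this, zFrac, qDiff, map_sub]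
  ring

theorem algebraMap_a {k : ℕ} (hk : k ≤ r) :
    algebraMap S (FractionRing S) (P.a k) = (nodePoly P.uFrac).coeff k := by
  have h1 : nodePoly P.uFrac = Polynomial.map (algebraMap S (FractionRing S))
      (((Finset.univ : Finset (Fin r)).val.map (fun i => (P.u i : S))).map
        fun t => Polynomial.X - Polynomial.C t).prod := by
    rw [Multiset.map_map, nodePoly, ← Polynomial.coe_mapRingHom, map_multiset_prod,
      Multiset.map_map]
    simp only [Function.comp_def, Polynomial.coe_mapRingHom, Polynomial.map_sub,
      Polynomial.map_X, Polynomial.map_C]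
    rfl
  rw [h1, Polynomial.coeff_map, Multiset.prod_X_sub_C_coeff _ (by simpa using hk), a]
  simp

theorem γ_eq_nodeWeight : P.γ = nodeWeight P.uFrac P.ρFrac P.zFrac := by
  funext j
  have : algebraMap S (FractionRing S) ((P.ρ : S) * (((P.q⁻¹ : Sˣ) : S) - (P.q : S))) =
      P.ρFrac * -P.zFrac := by
    rw [map_mul, ρFrac, zFrac, qDiff, ← map_neg, neg_sub]
  rw [γ, this, nodeWeight]

variable {P} in
theorem genericNodes (h1 : ∀ i j : Fin r, i ≠ j → P.u i ≠ P.u j)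
    (h2 : ∀ i j : Fin r, (P.u i : S) * (P.u j : S) ≠ 1) : GenericNodes P.uFrac where
  ne_zero i := algebraMap_unit_ne_zero (P.u i)
  injective i j h := by
    by_contra hij
    exact h1 i j hij (Units.ext (IsFractionRing.injective S (FractionRing S) h))
  mul_ne_one i j h := by
    refine h2 i j (IsFractionRing.injective S (FractionRing S) ?_)
    rw [map_mul, map_one]
    exact h

variable {P}

theorem wilcoxYu_iff_deltaFormula (hu : GenericNodes P.uFrac) (hz : P.qDiff ≠ 0) :
    P.WilcoxYuCondition ↔ P.DeltaFormulaCondition := by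
  have hinj := IsFractionRing.injective S (FractionRing S)
  have hδ0 : P.δ 0 ≠ 0 := P.isUnit_δ_zero.ne_zero
  -- For `r = 0` either condition would force `δ 0 = 0`, although `δ 0` is a unit.
  rcases Nat.eq_zero_or_pos r with rfl | hr
  · constructor
    · rintro ⟨-, -, h⟩
      exact absurd (by simpa using h 0 le_rfl) hδ0
    · intro h
      have h0 := h 0
      rw [univ_eq_empty, sum_empty, map_eq_zero_iff _ hinj] at h0
      exact absurd h0 hδ0
  rw [DeltaFormulaCondition, γ_eq_nodeWeight]
  refine Iff.trans ?_ (mk_mul_revNodePoly_iff hu P.ρFrac_ne_zero (zFrac_ne_zero hz)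
    (fun k => algebraMap S (FractionRing S) (P.δ k)))
  rw [mk_mul_revNodePoly_iff_coeff hu.ne_zero hr P.ρFrac_ne_zero (zFrac_ne_zero hz) _
    P.relation_frac]
  have hainv : algebraMap S (FractionRing S) ((-1) ^ r * ∏ i, (((P.u i)⁻¹ : Sˣ) : S)) =
      ((nodePoly P.uFrac).coeff 0)⁻¹ := by
    rw [← P.algebraMap_a (Nat.zero_le r)]
    refine eq_inv_of_mul_eq_one_right ?_
    rw [← map_mul, a_zero_mul_inv, map_one]
  have hsum (s : Finset ℕ) (f : ℕ → ℕ) (g : ℕ → S) (hs : ∀ j ∈ s, f j ≤ r) :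
      algebraMap S (FractionRing S) (∑ j ∈ s, P.a (f j) * g j) =
        ∑ j ∈ s, (nodePoly P.uFrac).coeff (f j) * algebraMap S (FractionRing S) (g j) := by
    rw [map_sum]
    exact sum_congr rfl fun j hj => by rw [map_mul, P.algebraMap_a (hs j hj)]
  have hsum1 (s : Finset ℕ) (f : ℕ → ℕ) (hs : ∀ j ∈ s, f j ≤ r) :
      algebraMap S (FractionRing S) (∑ j ∈ s, P.a (f j)) =
        ∑ j ∈ s, (nodePoly P.uFrac).coeff (f j) := by
    simpa using hsum s f (fun _ => 1) hs
  refine and_congr (forall₂_congr fun l hl => ?_) (and_congr ?_ (forall₂_congr fun b hb => ?_))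
  · rw [mem_Icc] at hl
    rw [← hinj.eq_iff, map_zero, map_add, map_mul, map_mul, map_add, map_sub, map_sub, map_mul,
      hainv, hsum, hsum1, hsum1, P.algebraMap_a (by omega), P.algebraMap_a (by omega), ρFrac, zFrac]
    all_goals
      intro j hj
      rw [mem_Icc] at hj
      omega
  · rw [← hinj.eq_iff, map_sub, map_mul, map_mul, hainv, algebraMap_ρ_inv,
      P.algebraMap_a (Nat.zero_le r), ρFrac, zFrac, apply_ite (algebraMap S (FractionRing S)),
      map_zero]
  · rw [← hinj.eq_iff, map_neg, hsum _ _ _ fun j hj => (mem_range.mp hj).le]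

theorem cauchySystem_γ (hu : GenericNodes P.uFrac) (hz : P.qDiff ≠ 0) :
    CauchySystem P.uFrac P.ρFrac P.zFrac P.γ :=
  (cauchySystem_iff_eq_nodeWeight hu P.ρFrac_ne_zero (zFrac_ne_zero hz) _).mpr P.γ_eq_nodeWeight

theorem DeltaFormulaCondition.pairing_pow (h : P.DeltaFormulaCondition) (k : ℕ) :
    pairing P.γ (fun i => P.uFrac i ^ k) = algebraMap S (FractionRing S) (P.δ k) :=
  (h k).symm

theorem DeltaFormulaCondition.pairing_one (h : P.DeltaFormulaCondition) :
    pairing P.γ 1 = algebraMap S (FractionRing S) (P.δ 0) := by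
  rw [← h.pairing_pow]
  simp only [pow_zero]
  rfl

/-- The power sums with negative exponents obey the recursion that defines `negδ`, by
`pairing_zpow_neg`. -/
theorem DeltaFormulaCondition.algebraMap_δInt (h : P.DeltaFormulaCondition)
    (hu : GenericNodes P.uFrac) (hz : P.qDiff ≠ 0) (b : ℤ) :
    algebraMap S (FractionRing S) (P.δInt b) = pairing P.γ (fun i => P.uFrac i ^ b) := by
  have hnat (n : ℕ) : algebraMap S (FractionRing S) (P.δInt n) =
      pairing P.γ (fun i => P.uFrac i ^ (n : ℤ)) := by
    rw [δInt_natCast, ← h.pairing_pow]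
    simp only [zpow_natCast]
  have hneg (n : ℕ) : ∀ b : ℤ, -(n : ℤ) ≤ b → algebraMap S (FractionRing S) (P.δInt b) =
      pairing P.γ (fun i => P.uFrac i ^ b) := by
    induction n with
    | zero =>
      intro b hb
      lift b to ℕ using by simpa using hb
      exact hnat b
    | succ n ih =>
      intro b hb
      rcases hb.eq_or_lt with rfl | hb
      · rw [P.δInt_neg (n + 1) (by omega)]
        have h1 := pairing_zpow_neg hu (cauchySystem_γ hu hz) P.ρFrac_ne_zero h.pairing_one
          P.relation_frac n
        simp only [Nat.cast_add, Nat.cast_one]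
        rw [h1, map_add, map_mul, map_pow, map_mul, map_mul, map_sum, algebraMap_ρ_inv,
          ← neg_sub, map_neg, ← qDiff, ← zFrac, Nat.add_sub_cancel]
        have h2 := hnat (n + 1)
        simp only [Nat.cast_add, Nat.cast_one] at h2
        rw [h2]
        have h3 : ∀ k ∈ Icc 1 n, algebraMap S (FractionRing S)
            (P.δInt k * P.δInt ((k : ℤ) - (n + 1)) - P.δInt (2 * (k : ℤ) - (n + 1))) =
            pairing P.γ (fun i => P.uFrac i ^ k) *
              pairing P.γ (fun i => P.uFrac i ^ ((k : ℤ) - (n + 1))) -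
            pairing P.γ (fun i => P.uFrac i ^ (2 * (k : ℤ) - (n + 1))) := by
          intro k hk
          rw [mem_Icc] at hk
          -- As `1 ≤ k`, both exponents `k - (n + 1)` and `2 * k - (n + 1)` are at least `-n`.
          rw [map_sub, map_mul, hnat k, ih _ (by omega), ih _ (by omega)]
          simp only [zpow_natCast]
        rw [sum_congr rfl h3]
        have h4 : (fun i => P.uFrac i ^ ((n : ℤ) + 1)) = fun i => P.uFrac i ^ (n + 1) := by
          funext i
          exact_mod_cast zpow_natCast (P.uFrac i) (n + 1)
        rw [h4]
        ring
      · exact ih b (by push_cast at hb; omega)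
  exact hneg b.natAbs b (by omega)

theorem sum_nodePoly_coeff_mul_pow {K : Type*} [Field K] (u : Fin r → K) (i : Fin r) :
    ∑ k ∈ range (r + 1), (nodePoly u).coeff k * u i ^ k = 0 := by
  have h := nodePoly_eval_self u i
  rwa [Polynomial.eval_eq_sum_range, nodePoly_natDegree] at h

theorem DeltaFormulaCondition.isWeaklyAdmissible (h : P.DeltaFormulaCondition)
    (hu : GenericNodes P.uFrac) (hz : P.qDiff ≠ 0) : P.IsWeaklyAdmissible := by
  intro b
  apply IsFractionRing.injective S (FractionRing S)
  rw [map_sum, map_zero]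
  have h1 : ∀ k ∈ range (r + 1), algebraMap S (FractionRing S) (P.a k * P.δInt ((k : ℤ) + b)) =
      ∑ j, P.γ j * P.uFrac j ^ b * ((nodePoly P.uFrac).coeff k * P.uFrac j ^ k) := by
    intro k hk
    rw [map_mul, P.algebraMap_a (by have := mem_range.mp hk; omega), h.algebraMap_δInt hu hz,
      pairing_apply, mul_sum]
    refine sum_congr rfl fun j _ => ?_
    rw [zpow_add₀ (hu.ne_zero j), zpow_natCast]
    ring
  rw [sum_congr rfl h1, sum_comm]
  refine sum_eq_zero fun j _ => ?_
  rw [← mul_sum, sum_nodePoly_coeff_mul_pow, mul_zero]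

end FractionField

end GroundRingParameters

/-! ### The representation over the field of fractions. -/

namespace GroundRingParameters

section Polynomials

open Polynomial Finset

/-- The polynomial `(X - u_1) ⋯ (X - u_r)` over the ground ring. -/
noncomputable def cyclotomicPoly {S : Type u} [CommRing S] {r : ℕ}
    (P : GroundRingParameters S r) : S[X] := ∏ i, (X - C (P.u i : S))

theorem prod_ofFn_eq_aeval {S A : Type*} [CommRing S] [Ring A] [Algebra S A] {r : ℕ}
    (P : GroundRingParameters S r) (y : A) :
    (List.ofFn fun i : Fin r => y - algebraMap S A (P.u i : S)).prod =
      aeval y P.cyclotomicPoly := by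
  rw [cyclotomicPoly, ← List.prod_ofFn, map_list_prod, List.map_ofFn]
  simp [Function.comp_def]

theorem map_cyclotomicPoly {S : Type u} [CommRing S] [IsDomain S] {r : ℕ} (P : GroundRingParameters S r) :
    P.cyclotomicPoly.map (algebraMap S (FractionRing S)) = nodePoly P.uFrac := by
  simp [cyclotomicPoly, nodePoly, Polynomial.map_prod, uFrac]

end Polynomials

section Representation

open Finset

variable {S : Type u} [CommRing S] [IsDomain S] {r : ℕ} (P : GroundRingParameters S r)

/-- The operators by which the generators act on the vectors of values at the nodes. -/
noncomputable def generatorOp : BMWGenerator 2 → Module.End (FractionRing S) (Fin r → FractionRing S)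
  | .y => diagOp P.uFrac
  | .yInv => diagOp P.uFrac⁻¹
  | .g _ => gOp P.uFrac P.zFrac P.γ
  | .gInv _ => gOp P.uFrac P.zFrac P.γ - P.zFrac • (1 - eOp P.γ)
  | .e _ => eOp P.γ

/-- The action of the free algebra on the vectors of values at the nodes. -/
noncomputable def freeRep :
    FreeAlgebra S (BMWGenerator 2) →ₐ[S] Module.End (FractionRing S) (Fin r → FractionRing S) :=
  FreeAlgebra.lift S P.generatorOp

theorem aeval_diagOp_apply (d v : Fin r → FractionRing S) (f : Polynomial S) (i : Fin r) :
    Polynomial.aeval (diagOp d : Module.End (FractionRing S) (Fin r → FractionRing S)) f v i =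
      Polynomial.aeval (d i) f * v i := by
  induction f using Polynomial.induction_on' with
  | add f g hf hg => simp [hf, hg, add_mul]
  | monomial n c =>
    have h (n : ℕ) : ((diagOp d : Module.End (FractionRing S) (Fin r → FractionRing S)) ^ n) v i =
        d i ^ n * v i := by
      induction n with
      | zero => simp
      | succ n ih => rw [pow_succ', Module.End.mul_apply, diagOp_apply, ih, pow_succ', mul_assoc]
    rw [Polynomial.aeval_monomial, Polynomial.aeval_monomial, Module.End.mul_apply,
      Module.algebraMap_end_apply, Pi.smul_apply, h, Algebra.smul_def, mul_assoc]

theorem pow_diagOp_apply (d v : Fin r → FractionRing S) (n : ℕ) (i : Fin r) :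
    ((diagOp d : Module.End (FractionRing S) (Fin r → FractionRing S)) ^ n) v i =
      d i ^ n * v i := by
  simpa using aeval_diagOp_apply d v (Polynomial.X ^ n) i

variable {P}

theorem freeRep_rel (hu : GenericNodes P.uFrac) (hz : P.qDiff ≠ 0)
    (h : P.DeltaFormulaCondition) {a b : FreeAlgebra S (BMWGenerator 2)} (hab : P.BMWRel 2 a b) :
    P.freeRep a = P.freeRep b := by
  have hC := cauchySystem_γ hu hz
  have h1 := h.pairing_one
  have hrel := P.relation_frac
  have hρ := P.ρFrac_ne_zero
  set G : Module.End (FractionRing S) (Fin r → FractionRing S) :=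
    gOp P.uFrac P.zFrac P.γ with hG
  set E : Module.End (FractionRing S) (Fin r → FractionRing S) := eOp P.γ with hE
  set Y : Module.End (FractionRing S) (Fin r → FractionRing S) := diagOp P.uFrac with hY
  set Y' : Module.End (FractionRing S) (Fin r → FractionRing S) := diagOp P.uFrac⁻¹ with hY'
  have ry : P.freeRep (FreeAlgebra.ι S BMWGenerator.y) = Y := by
    rw [freeRep, FreeAlgebra.lift_ι_apply]; rfl
  have ry' : P.freeRep (FreeAlgebra.ι S BMWGenerator.yInv) = Y' := by
    rw [freeRep, FreeAlgebra.lift_ι_apply]; rfl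
  have rg (i) : P.freeRep (FreeAlgebra.ι S (BMWGenerator.g i)) = G := by
    rw [freeRep, FreeAlgebra.lift_ι_apply]; rfl
  have rg' (i) : P.freeRep (FreeAlgebra.ι S (BMWGenerator.gInv i)) =
      G - P.zFrac • (1 - E) := by
    rw [freeRep, FreeAlgebra.lift_ι_apply]; rfl
  have re (i) : P.freeRep (FreeAlgebra.ι S (BMWGenerator.e i)) = E := by
    rw [freeRep, FreeAlgebra.lift_ι_apply]; rfl
  have hsmul (s : S) (T : Module.End (FractionRing S) (Fin r → FractionRing S)) :
      s • T = algebraMap S (FractionRing S) s • T := by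
    ext; simp [Algebra.smul_def]
  have hGG : G * G = 1 + P.zFrac • G - (P.zFrac * P.ρFrac⁻¹) • E :=
    gOp_comp_gOp hu hC hρ h1 hrel
  have hGYG : G * (Y * G) = Y' := gOp_comp_diagOp_comp_gOp hu hC hρ h1 hrel
  have hYY' : Y * Y' = 1 := by
    refine LinearMap.ext fun v => funext fun i => ?_
    simp [hY, hY', diagOp_apply, hu.ne_zero i]
  have hY'Y : Y' * Y = 1 := by
    refine LinearMap.ext fun v => funext fun i => ?_
    simp [hY, hY', diagOp_apply, hu.ne_zero i]
  have hGE : G * E = P.ρFrac⁻¹ • E := by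
    refine LinearMap.ext fun v => ?_
    rw [Module.End.mul_apply, hE, eOp_eq_smul, map_smul, hG, gOp_one hC, LinearMap.smul_apply,
      eOp_eq_smul, smul_comm]
  have hEG : E * G = P.ρFrac⁻¹ • E := by
    refine LinearMap.ext fun v => ?_
    rw [Module.End.mul_apply, hE, eOp_eq_smul, hG, pairing_gOp hC, LinearMap.smul_apply,
      eOp_eq_smul, smul_smul]
  have hEYE (k : ℕ) : E * Y ^ k * E = algebraMap S (FractionRing S) (P.δ k) • E := by
    refine LinearMap.ext fun v => ?_
    have : (Y ^ k) 1 = fun i => P.uFrac i ^ k := by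
      funext i
      rw [hY, pow_diagOp_apply, Pi.one_apply, mul_one]
    rw [Module.End.mul_apply, Module.End.mul_apply, hE, eOp_eq_smul _ v, map_smul, map_smul, this,
      eOp_eq_smul, h.pairing_pow, LinearMap.smul_apply, eOp_eq_smul, smul_comm]
  have hnode := mul_gOp_node hu hC h1 hrel
  have hYone : Y 1 = P.uFrac := mul_one P.uFrac
  have hEYGY : E * Y * G * Y = P.ρFrac • E := by
    refine LinearMap.ext fun v => ?_
    have h2 : pairing P.γ (P.uFrac * gOp P.uFrac P.zFrac P.γ (P.uFrac * v)) =
        P.ρFrac * pairing P.γ v := by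
      rw [pairing_mul_gOp, ← mul_assoc, mul_comm _ P.uFrac, hnode, smul_mul_assoc, one_mul,
        map_smul, smul_eq_mul]
    change eOp P.γ (P.uFrac * gOp P.uFrac P.zFrac P.γ (P.uFrac * v)) = P.ρFrac • eOp P.γ v
    rw [eOp_eq_smul, eOp_eq_smul, h2, smul_smul]
  have hYGYE : Y * G * Y * E = P.ρFrac • E := by
    refine LinearMap.ext fun v => ?_
    rw [Module.End.mul_apply, hE, eOp_eq_smul, map_smul, LinearMap.smul_apply, eOp_eq_smul,
      smul_comm]
    congr 1
    rw [Module.End.mul_apply, Module.End.mul_apply, hYone]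
    exact hnode
  cases hab with
  | g_mul_gInv i =>
    simp only [map_mul, map_one, rg, rg', mul_sub, mul_smul_comm, hGG, hGE, mul_one, smul_sub, smul_smul]
    abel
  | gInv_mul_g i =>
    simp only [map_mul, map_one, rg, rg', sub_mul, smul_mul_assoc, hGG, hEG, one_mul, smul_sub, smul_smul]
    abel
  | y_mul_yInv => simp only [map_mul, map_one, ry, ry', hYY']
  | yInv_mul_y => simp only [map_mul, map_one, ry, ry', hY'Y]
  | e_mul_e i =>
    have := hEYE 0
    rw [pow_zero, mul_one] at this
    simp only [map_mul, map_smul, re, this, hsmul]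
  -- On two strands there is a single index, so relations between different indices, or for indices
  -- after the first, are void.
  | braid i j h => omega
  | g_comm_g i j h => unfold Distant at h; omega
  | affine_braid i h =>
    simp only [map_mul, ry, rg]
    rw [mul_assoc Y G Y, mul_assoc Y (G * Y) G, mul_assoc G Y G, hGYG, hYY', hY'Y]
  | y_comm_g i h => omega
  | g_comm_e i j h => unfold Distant at h; omega
  | e_comm_e i j h => unfold Distant at h; omega
  | y_comm_e i h => omega
  | e_e_e i j h => unfold Adjacent at h; omega
  | g_g_e i j h => unfold Adjacent at h; omega
  | e_g_g i j h => unfold Adjacent at h; omega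
  | e_y_pow_e i h j hj => simp only [map_mul, map_pow, map_smul, re, ry, hEYE, hsmul]
  | skein i =>
    simp only [map_sub, map_smul, map_one, rg, rg', re, hsmul]
    rw [zFrac]
    abel
  | g_e i => simp only [map_mul, map_smul, rg, re, hGE, hsmul, algebraMap_ρ_inv]
  | e_g i => simp only [map_mul, map_smul, rg, re, hEG, hsmul, algebraMap_ρ_inv]
  | e_g_e i j h => unfold Adjacent at h; omega
  | e_y_g_y i h =>
    simp only [map_mul, map_smul, rg, re, ry, hEYGY, hsmul]
    rfl
  | y_g_y_e i h =>
    simp only [map_mul, map_smul, rg, re, ry, hYGYE, hsmul]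
    rfl
  | cyclotomic =>
    rw [prod_ofFn_eq_aeval, ← Polynomial.aeval_algHom_apply, ry, map_zero]
    refine LinearMap.ext fun v => funext fun i => ?_
    rw [hY, aeval_diagOp_apply, ← Polynomial.aeval_map_algebraMap (FractionRing S),
      map_cyclotomicPoly, Polynomial.coe_aeval_eq_eval, nodePoly_eval_self, zero_mul]
    rfl

end Representation

end GroundRingParameters

/-! ### The stable lattice: (G) ⇒ (M). -/

namespace GroundRingParameters

section Lattice

open Finset

variable {S : Type u} [CommRing S] {r : ℕ} (P : GroundRingParameters S r)

/-- The vector of the `k`-th powers of the nodes. -/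
noncomputable def nodeVec (k : ℕ) : Fin r → FractionRing S := fun i => P.uFrac i ^ k

/-- The `S`-lattice spanned by the first `r` power vectors. -/
noncomputable def lattice : Submodule S (Fin r → FractionRing S) :=
  Submodule.span S (Set.range fun k : Fin r => P.nodeVec k)

theorem nodeVec_zero : P.nodeVec 0 = 1 := by
  funext i
  simp [nodeVec]

theorem sum_a_smul_nodeVec [IsDomain S] (n : ℕ) :
    ∑ k ∈ range (r + 1), P.a k • P.nodeVec (n + k) = 0 := by
  funext i
  rw [Finset.sum_apply, Pi.zero_apply, ← mul_zero (P.uFrac i ^ n),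
    ← sum_nodePoly_coeff_mul_pow P.uFrac i, mul_sum]
  refine sum_congr rfl fun k hk => ?_
  rw [Pi.smul_apply, Algebra.smul_def, P.algebraMap_a (by have := mem_range.mp hk; omega), nodeVec,
    pow_add]
  ring

theorem a_self : P.a r = 1 := by
  simp [a, Multiset.esymm]

theorem isUnit_a_zero : IsUnit (P.a 0) :=
  IsUnit.of_mul_eq_one _ P.a_zero_mul_inv

/-- The polynomial with roots `u_i` is monic with coefficients in `S`, so higher powers reduce to
lower ones. -/
theorem nodeVec_mem [IsDomain S] (n : ℕ) : P.nodeVec n ∈ P.lattice := by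
  induction n using Nat.strong_induction_on with
  | _ n ih =>
    rcases lt_or_ge n r with h | h
    · exact Submodule.subset_span ⟨⟨n, h⟩, rfl⟩
    · have h1 := P.sum_a_smul_nodeVec (n - r)
      rw [sum_range_succ, a_self, one_smul, Nat.sub_add_cancel h] at h1
      rw [eq_neg_of_add_eq_zero_right h1]
      refine neg_mem (sum_mem fun k hk => P.lattice.smul_mem _ (ih _ ?_))
      have := mem_range.mp hk
      omega

theorem smul_mem_lattice_of_algebraMap (s : S) {v : Fin r → FractionRing S} (hv : v ∈ P.lattice) :
    algebraMap S (FractionRing S) s • v ∈ P.lattice := by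
  rw [algebraMap_smul]
  exact P.lattice.smul_mem s hv

theorem mem_lattice_of_forall_nodeVec
    (T : Module.End (FractionRing S) (Fin r → FractionRing S))
    (h : ∀ k, T (P.nodeVec k) ∈ P.lattice) {v : Fin r → FractionRing S} (hv : v ∈ P.lattice) :
    T v ∈ P.lattice := by
  have : P.lattice ≤ P.lattice.comap (T.restrictScalars S) := by
    conv_lhs => rw [lattice]
    rw [Submodule.span_le]
    rintro _ ⟨k, rfl⟩
    exact h k
  exact this hv

variable [IsDomain S] {P}

theorem diagOp_mem_lattice {v : Fin r → FractionRing S} (hv : v ∈ P.lattice) :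
    diagOp P.uFrac v ∈ P.lattice := by
  refine P.mem_lattice_of_forall_nodeVec (diagOp P.uFrac) (fun k => ?_) hv
  have : diagOp P.uFrac (P.nodeVec k) = P.nodeVec (k + 1) := by
    funext i
    rw [diagOp_apply, nodeVec, nodeVec, pow_succ']
  rw [this]
  exact P.nodeVec_mem _

theorem diagOp_inv_mem_lattice (hu : GenericNodes P.uFrac) {v : Fin r → FractionRing S}
    (hv : v ∈ P.lattice) : diagOp P.uFrac⁻¹ v ∈ P.lattice := by
  have hinv (k : ℕ) : diagOp P.uFrac⁻¹ (P.nodeVec (k + 1)) = P.nodeVec k := by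
    funext i
    have := hu.ne_zero i
    rw [diagOp_apply, nodeVec, nodeVec, pow_succ', Pi.inv_apply, inv_mul_cancel_left₀ this]
  refine P.mem_lattice_of_forall_nodeVec (diagOp P.uFrac⁻¹) (fun k => ?_) hv
  cases k with
  | zero =>
    -- Multiplying the relation `∑ a_k y^k = 0` by `y⁻¹` expresses `a_0 y⁻¹` through non-negative
    -- powers, and `a_0` is a unit of `S`.
    have h1 := congrArg (diagOp P.uFrac⁻¹) (P.sum_a_smul_nodeVec 0)
    rw [map_zero, map_sum, sum_range_succ'] at h1
    have hs (s : S) (w : Fin r → FractionRing S) :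
        diagOp P.uFrac⁻¹ (s • w) = s • diagOp P.uFrac⁻¹ w :=
      ((diagOp P.uFrac⁻¹).restrictScalars S).map_smul s w
    simp only [hs, zero_add, hinv] at h1
    obtain ⟨w, hw⟩ := P.isUnit_a_zero
    have h2 : (w : S) • diagOp P.uFrac⁻¹ (P.nodeVec 0) ∈ P.lattice := by
      rw [hw, eq_neg_of_add_eq_zero_right h1]
      exact neg_mem (sum_mem fun k _ => P.lattice.smul_mem _ (P.nodeVec_mem k))
    have h3 := P.lattice.smul_mem ((w⁻¹ : Sˣ) : S) h2
    rwa [smul_smul, Units.inv_mul, one_smul] at h3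
  | succ k =>
    rw [hinv]
    exact P.nodeVec_mem k

theorem eOp_nodeVec (h : P.DeltaFormulaCondition) (k : ℕ) :
    eOp P.γ (P.nodeVec k) = P.δ k • P.nodeVec 0 := by
  rw [eOp_eq_smul, nodeVec_zero, ← algebraMap_smul (FractionRing S) (P.δ k), ← h.pairing_pow]
  rfl

theorem eOp_mem_lattice (h : P.DeltaFormulaCondition) {v : Fin r → FractionRing S}
    (hv : v ∈ P.lattice) : eOp P.γ v ∈ P.lattice := by
  refine P.mem_lattice_of_forall_nodeVec (eOp P.γ) (fun k => ?_) hv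
  rw [eOp_nodeVec h]
  exact P.lattice.smul_mem _ (P.nodeVec_mem 0)

/-- The entries of `gOp` have denominators, but `g y^{k+1} = y⁻¹ (g - z (1 - e)) y^k` on the vector
`1` gives integrality by induction, starting from `g 1 = ρ⁻¹ 1`. -/
theorem gOp_mem_lattice (hu : GenericNodes P.uFrac) (hz : P.qDiff ≠ 0)
    (h : P.DeltaFormulaCondition) {v : Fin r → FractionRing S} (hv : v ∈ P.lattice) :
    gOp P.uFrac P.zFrac P.γ v ∈ P.lattice := by
  refine P.mem_lattice_of_forall_nodeVec (gOp P.uFrac P.zFrac P.γ) (fun k => ?_) hv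
  induction k with
  | zero =>
    rw [nodeVec_zero, gOp_one (cauchySystem_γ hu hz), ← nodeVec_zero, ← algebraMap_ρ_inv]
    exact P.smul_mem_lattice_of_algebraMap _ (P.nodeVec_mem 0)
  | succ k ih =>
    have h1 := mul_gOp_mul (z := P.zFrac) (γ := P.γ) hu (P.nodeVec k)
    have h2 : P.uFrac * P.nodeVec k = P.nodeVec (k + 1) := by
      funext i
      rw [Pi.mul_apply, nodeVec, nodeVec, pow_succ']
    have h3 : gOp P.uFrac P.zFrac P.γ (P.nodeVec (k + 1)) = diagOp P.uFrac⁻¹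
        (gOp P.uFrac P.zFrac P.γ (P.nodeVec k) -
          P.zFrac • (P.nodeVec k - eOp P.γ (P.nodeVec k))) := by
      rw [← h1, h2]
      funext i
      have := hu.ne_zero i
      rw [diagOp_apply, Pi.mul_apply, Pi.inv_apply, inv_mul_cancel_left₀ this]
    rw [h3]
    exact diagOp_inv_mem_lattice hu (sub_mem ih (P.smul_mem_lattice_of_algebraMap _
      (sub_mem (P.nodeVec_mem k) (eOp_mem_lattice h (P.nodeVec_mem k)))))

theorem generatorOp_mem_lattice (hu : GenericNodes P.uFrac) (hz : P.qDiff ≠ 0)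
    (h : P.DeltaFormulaCondition) (x : BMWGenerator 2) {v : Fin r → FractionRing S}
    (hv : v ∈ P.lattice) : P.generatorOp x v ∈ P.lattice := by
  cases x with
  | y => exact diagOp_mem_lattice hv
  | yInv => exact diagOp_inv_mem_lattice hu hv
  | g i => exact gOp_mem_lattice hu hz h hv
  | gInv i =>
    exact sub_mem (gOp_mem_lattice hu hz h hv) (P.smul_mem_lattice_of_algebraMap _
      (sub_mem hv (eOp_mem_lattice h hv)))
  | e i => exact eOp_mem_lattice h hv

/-- The action of the free algebra on the lattice. -/
noncomputable def freeLatticeRep (hu : GenericNodes P.uFrac) (hz : P.qDiff ≠ 0)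
    (h : P.DeltaFormulaCondition) :
    FreeAlgebra S (BMWGenerator 2) →ₐ[S] Module.End S P.lattice :=
  FreeAlgebra.lift S fun x => ((P.generatorOp x).restrictScalars S).restrict
    fun _ hv => generatorOp_mem_lattice hu hz h x hv

theorem coe_freeLatticeRep (hu : GenericNodes P.uFrac) (hz : P.qDiff ≠ 0)
    (h : P.DeltaFormulaCondition) (w : FreeAlgebra S (BMWGenerator 2)) (v : P.lattice) :
    (freeLatticeRep hu hz h w v : Fin r → FractionRing S) = P.freeRep w v := by
  induction w using FreeAlgebra.induction generalizing v with
  | grade0 s => simp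
  | grade1 x =>
    rw [freeLatticeRep, freeRep, FreeAlgebra.lift_ι_apply, FreeAlgebra.lift_ι_apply]
    rfl
  | mul a b ha hb => simp [ha, hb]
  | add a b ha hb => simp [ha, hb]

/-- The action of the two-strand algebra on the lattice. -/
noncomputable def latticeRep (hu : GenericNodes P.uFrac) (hz : P.qDiff ≠ 0)
    (h : P.DeltaFormulaCondition) : P.CyclotomicBMW 2 →ₐ[S] Module.End S P.lattice :=
  RingQuot.liftAlgHom S ⟨freeLatticeRep hu hz h, fun a b hab => LinearMap.ext fun v =>
    Subtype.ext (by rw [coe_freeLatticeRep, coe_freeLatticeRep, freeRep_rel hu hz h hab])⟩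

theorem coe_latticeRep_mkAlgHom (hu : GenericNodes P.uFrac) (hz : P.qDiff ≠ 0)
    (h : P.DeltaFormulaCondition) (w : FreeAlgebra S (BMWGenerator 2)) (v : P.lattice) :
    (latticeRep hu hz h (RingQuot.mkAlgHom S (P.BMWRel 2) w) v : Fin r → FractionRing S) =
      P.freeRep w v := by
  rw [latticeRep, RingQuot.liftAlgHom_mkAlgHom_apply, coe_freeLatticeRep]

theorem linearIndependent_nodeVec (hu : GenericNodes P.uFrac) :
    LinearIndependent S fun k : Fin r => P.nodeVec k := by
  have h1 : LinearIndependent (FractionRing S) fun k : Fin r => P.nodeVec k := by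
    have h2 : IsUnit (Matrix.vandermonde P.uFrac) := by
      rw [Matrix.isUnit_iff_isUnit_det, isUnit_iff_ne_zero]
      exact Matrix.det_vandermonde_ne_zero_iff.mpr hu.injective
    exact Matrix.linearIndependent_cols_iff_isUnit.mpr h2
  refine h1.restrict_scalars fun s t hst => ?_
  simpa [Algebra.smul_def] using hst

/-- The power vectors as a basis of the lattice. -/
noncomputable def latticeBasis (hu : GenericNodes P.uFrac) : Module.Basis (Fin r) S P.lattice :=
  Module.Basis.span (linearIndependent_nodeVec hu)

theorem coe_latticeBasis (hu : GenericNodes P.uFrac) (k : Fin r) :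
    (latticeBasis hu k : Fin r → FractionRing S) = P.nodeVec k :=
  congrArg Subtype.val (Module.Basis.span_apply (linearIndependent_nodeVec hu) k)

theorem DeltaFormulaCondition.basisModuleCondition (h : P.DeltaFormulaCondition)
    (hu : GenericNodes P.uFrac) (hz : P.qDiff ≠ 0) : P.BasisModuleCondition := by
  refine ⟨h.isWeaklyAdmissible hu hz, P.lattice, P.lattice.addCommGroup, P.lattice.module,
    Module.compHom P.lattice (latticeRep hu hz h).toRingHom, ?_, ⟨P.nodeVec 0, P.nodeVec_mem 0⟩,
    latticeBasis hu, fun k => ?_, ?_⟩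
  · let _ := Module.compHom P.lattice (latticeRep hu hz h).toRingHom
    refine ⟨fun s w v => ?_⟩
    change latticeRep hu hz h (s • w) v = s • latticeRep hu hz h w v
    rw [map_smul, LinearMap.smul_apply]
  · refine Subtype.ext ?_
    rw [coe_latticeBasis]
    change _ = ((latticeRep hu hz h (P.y ^ (k : ℕ)) ⟨P.nodeVec 0, P.nodeVec_mem 0⟩ : P.lattice) :
      Fin r → FractionRing S)
    rw [y, ← map_pow, coe_latticeRep_mkAlgHom, map_pow, freeRep, FreeAlgebra.lift_ι_apply]
    funext i
    change _ = ((diagOp P.uFrac : Module.End (FractionRing S) (Fin r → FractionRing S)) ^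
      (k : ℕ)) (P.nodeVec 0) i
    rw [pow_diagOp_apply, nodeVec_zero, Pi.one_apply, mul_one]
    rfl
  · refine Subtype.ext ?_
    change ((latticeRep hu hz h P.e ⟨P.nodeVec 0, P.nodeVec_mem 0⟩ : P.lattice) :
      Fin r → FractionRing S) = P.δ 0 • P.nodeVec 0
    rw [e, coe_latticeRep_mkAlgHom, freeRep, FreeAlgebra.lift_ι_apply]
    exact eOp_nodeVec h 0

end Lattice

end GroundRingParameters

/-! ### Computation in the two-strand algebra: (M) ⇒ (L), and an annihilating polynomial. -/

namespace GroundRingParameters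

section TwoStrand

open Polynomial

variable {S : Type u} [CommRing S] {r : ℕ} {P : GroundRingParameters S r}

/-- Acting on `v₀` sends `y^k e` to `δ₀ y^k v₀`, a unit multiple of a basis vector. -/
theorem BasisModuleCondition.linearIndependenceCondition (h : P.BasisModuleCondition) :
    P.LinearIndependenceCondition := by
  obtain ⟨hw, M, _, _, _, _, v₀, b, hb, he⟩ := h
  refine ⟨hw, LinearIndependent.of_comp
    ((LinearMap.toSpanSingleton (P.CyclotomicBMW 2) M v₀).restrictScalars S) ?_⟩
  obtain ⟨d, hd⟩ := P.isUnit_δ_zero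
  convert! b.linearIndependent.units_smul (fun _ => d) using 1
  funext k
  change (P.y ^ (k : ℕ) * P.e) • v₀ = (d : S) • b k
  rw [mul_smul, he, hb, hd, smul_comm]

variable (P)

/-- The element `g₁` of the two-strand algebra. -/
def g : P.CyclotomicBMW 2 := RingQuot.mkAlgHom S (P.BMWRel 2) (freeG S (n := 2) 0)

/-- The inverse of `g₁` in the two-strand algebra. -/
def gInv : P.CyclotomicBMW 2 := RingQuot.mkAlgHom S (P.BMWRel 2) (freeGInv S (n := 2) 0)

theorem gInv_mul_g : P.gInv * P.g = 1 := by
  simpa [g, gInv] using RingQuot.mkAlgHom_rel S (BMWRel.gInv_mul_g (P := P) (n := 2) 0)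

theorem gInv_eq : P.gInv = P.g - P.qDiff • (1 - P.e) := by
  have := RingQuot.mkAlgHom_rel S (BMWRel.skein (P := P) (n := 2) 0)
  simp only [map_sub, map_smul, map_one] at this
  change P.g - P.gInv = P.qDiff • (1 - P.e) at this
  rw [← this, sub_sub_cancel]

theorem g_mul_e : P.g * P.e = ((P.ρ⁻¹ : Sˣ) : S) • P.e := by
  have := RingQuot.mkAlgHom_rel S (BMWRel.g_e (P := P) (n := 2) 0)
  simp only [map_mul, map_smul] at this
  exact this

theorem y_g_y_g : P.y * P.g * P.y * P.g = P.g * P.y * P.g * P.y := by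
  have := RingQuot.mkAlgHom_rel S (BMWRel.affine_braid (P := P) (n := 2) 0 rfl)
  simp only [map_mul] at this
  exact this

theorem y_g_y_e : P.y * P.g * P.y * P.e = (P.ρ : S) • P.e := by
  have := RingQuot.mkAlgHom_rel S (BMWRel.y_g_y_e (P := P) (n := 2) 0 rfl)
  simp only [map_mul, map_smul] at this
  exact this

theorem e_y_pow_e (k : ℕ) : P.e * P.y ^ k * P.e = P.δ k • P.e := by
  rcases Nat.eq_zero_or_pos k with rfl | hk
  · have := RingQuot.mkAlgHom_rel S (BMWRel.e_mul_e (P := P) (n := 2) 0)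
    rw [pow_zero, mul_one]
    simp only [map_mul, map_smul] at this
    exact this
  · have := RingQuot.mkAlgHom_rel S (BMWRel.e_y_pow_e (P := P) (n := 2) 0 rfl k hk)
    simp only [map_mul, map_smul, map_pow] at this
    exact this

theorem aeval_y_cyclotomicPoly : aeval P.y P.cyclotomicPoly = 0 := by
  have := RingQuot.mkAlgHom_rel S (BMWRel.cyclotomic (P := P) (n := 2))
  rw [prod_ofFn_eq_aeval, map_zero, ← aeval_algHom_apply] at this
  exact this

/-- The element `g y g y` fixes `e` by the unwrapping and untwisting relations, and it commutes with
`y` by the affine braid relation. -/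
theorem g_y_g_y_pow_e (k : ℕ) : P.g * P.y * P.g * P.y ^ (k + 1) * P.e = P.y ^ k * P.e := by
  induction k with
  | zero =>
    calc P.g * P.y * P.g * P.y ^ (0 + 1) * P.e = P.g * (P.y * P.g * P.y * P.e) := by
          simp only [zero_add, pow_one, mul_assoc]
      _ = P.y ^ 0 * P.e := by
          rw [y_g_y_e, mul_smul_comm, g_mul_e, smul_smul, Units.mul_inv, one_smul, pow_zero,
            one_mul]
  | succ k ih =>
    calc P.g * P.y * P.g * P.y ^ (k + 1 + 1) * P.e
        = (P.g * P.y * P.g * P.y) * P.y ^ (k + 1) * P.e := by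
          rw [pow_succ' _ (k + 1)]; simp only [mul_assoc]
      _ = P.y * (P.g * P.y * P.g * P.y ^ (k + 1) * P.e) := by
          rw [← y_g_y_g]; simp only [mul_assoc]
      _ = P.y ^ (k + 1) * P.e := by rw [ih, pow_succ', mul_assoc]

theorem y_g_y_pow_e (k : ℕ) : P.y * (P.g * (P.y ^ (k + 1) * P.e)) =
    P.g * (P.y ^ k * P.e) - P.qDiff • (P.y ^ k * P.e - P.δ k • P.e) := by
  calc P.y * (P.g * (P.y ^ (k + 1) * P.e))
      = P.gInv * P.g * (P.y * (P.g * (P.y ^ (k + 1) * P.e))) := by rw [gInv_mul_g, one_mul]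
    _ = P.gInv * (P.g * P.y * P.g * P.y ^ (k + 1) * P.e) := by simp only [mul_assoc]
    _ = _ := by
      rw [g_y_g_y_pow_e, gInv_eq, sub_mul, smul_mul_assoc, sub_mul, one_mul, ← mul_assoc P.e,
        e_y_pow_e]

/-- The polynomials that express `y ^ k g y ^ k e` as a polynomial in `y` times `e`. -/
noncomputable def twistPoly : ℕ → S[X]
  | 0 => C ((P.ρ⁻¹ : Sˣ) : S)
  | k + 1 => twistPoly k - C P.qDiff * (X ^ k * (X ^ k - C (P.δ k)))

theorem y_pow_g_y_pow_e (k : ℕ) :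
    P.y ^ k * (P.g * (P.y ^ k * P.e)) = aeval P.y (P.twistPoly k) * P.e := by
  induction k with
  | zero => simp [twistPoly, g_mul_e, Algebra.smul_def]
  | succ k ih =>
    calc P.y ^ (k + 1) * (P.g * (P.y ^ (k + 1) * P.e))
        = P.y ^ k * (P.y * (P.g * (P.y ^ (k + 1) * P.e))) := by
          rw [pow_succ _ k]; simp only [mul_assoc]
      _ = _ := by
          rw [y_g_y_pow_e, mul_sub, ih, twistPoly, map_sub, sub_mul]
          congr 1
          simp only [map_mul, aeval_C, map_sub, map_pow, aeval_X, ← Algebra.smul_def,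
            smul_mul_assoc, mul_smul_comm, mul_assoc, sub_mul]

/-- This is `y^r g p(y) e = 0`, with `p` the cyclotomic polynomial. The factor `y^r` supplies the
`y^k` needed to the left of each `g y^k e`, so that no negative powers arise. -/
theorem aeval_y_sum_twistPoly :
    aeval P.y (∑ k ∈ Finset.range (r + 1),
      C (P.cyclotomicPoly.coeff k) * (X ^ (r - k) * P.twistPoly k)) * P.e = 0 := by
  have hdeg : P.cyclotomicPoly.natDegree < r + 1 := by
    rcases subsingleton_or_nontrivial S with h | h
    · rw [Subsingleton.elim P.cyclotomicPoly 0]; simp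
    · simp [cyclotomicPoly]
  have h1 : P.y ^ r * (P.g * (aeval P.y P.cyclotomicPoly * P.e)) = 0 := by
    rw [aeval_y_cyclotomicPoly, zero_mul, mul_zero, mul_zero]
  rw [← h1, aeval_eq_sum_range' hdeg, map_sum, Finset.sum_mul, Finset.sum_mul, Finset.mul_sum,
    Finset.mul_sum]
  refine Finset.sum_congr rfl fun k hk => ?_
  have hk' : r = r - k + k := by have := Finset.mem_range.mp hk; omega
  rw [map_mul, aeval_C, ← Algebra.smul_def, map_mul, smul_mul_assoc, mul_assoc,
    ← y_pow_g_y_pow_e, map_pow, aeval_X, smul_mul_assoc, mul_smul_comm, mul_smul_comm, ← mul_assoc,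
    ← pow_add, ← hk']

end TwoStrand

/-! ### From linear independence to the Cauchy system: (L) ⇒ (G). -/

section Integral

open Polynomial

variable {S : Type u} [CommRing S] [IsDomain S] {r : ℕ} {P : GroundRingParameters S r}

/-- The remainder of `f` modulo the cyclotomic polynomial also annihilates `e`. Having degree less
than `r`, it is zero by linear independence, so `f` is a multiple of a polynomial that vanishes at
the nodes. -/
theorem LinearIndependenceCondition.aeval_uFrac_eq_zero (h : P.LinearIndependenceCondition)
    {f : S[X]} (hf : aeval P.y f * P.e = 0) (i : Fin r) : aeval (P.uFrac i) f = 0 := by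
  have hmonic : P.cyclotomicPoly.Monic := monic_prod_of_monic _ _ fun i _ => monic_X_sub_C _
  have hdeg : P.cyclotomicPoly.natDegree = r := by simp [cyclotomicPoly]
  have hne : P.cyclotomicPoly ≠ 1 := by
    intro h1
    have := i.pos
    rw [h1, natDegree_one] at hdeg
    omega
  have hlt : (f %ₘ P.cyclotomicPoly).natDegree < r := by
    have := natDegree_modByMonic_lt f hmonic hne
    rwa [hdeg] at this
  have h1 : aeval P.y (f %ₘ P.cyclotomicPoly) * P.e = 0 := by
    rwa [aeval_modByMonic_eq_self_of_root P.aeval_y_cyclotomicPoly]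
  rw [aeval_eq_sum_range' hlt, Finset.sum_mul, Finset.sum_range] at h1
  simp only [smul_mul_assoc] at h1
  have h2 := Fintype.linearIndependent_iff.mp h.2 _ h1
  have h3 : f %ₘ P.cyclotomicPoly = 0 := by
    ext k
    rcases lt_or_ge k r with hk | hk
    · exact h2 ⟨k, hk⟩
    · exact coeff_eq_zero_of_natDegree_lt (hlt.trans_le hk)
  obtain ⟨c, rfl⟩ := (modByMonic_eq_zero_iff_dvd hmonic).mp h3
  rw [map_mul, ← aeval_map_algebraMap (FractionRing S), map_cyclotomicPoly, coe_aeval_eq_eval,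
    nodePoly_eval_self, zero_mul]

theorem cyclotomicPoly_coeff (k : ℕ) :
    algebraMap S (FractionRing S) (P.cyclotomicPoly.coeff k) = (nodePoly P.uFrac).coeff k := by
  rw [← map_cyclotomicPoly, coeff_map]

/-- The recursion of `twistPoly` mirrors `mul_gOp_mul`, which is valid for arbitrary weights. The
discrepancy between the two is independent of `k`, and `k = 0` shows it to be the left-hand side of
the `i`-th Cauchy equation. -/
theorem aeval_twistPoly (hu : GenericNodes P.uFrac) {γ : Fin r → FractionRing S}
    (hγ : ∀ k, algebraMap S (FractionRing S) (P.δ k) = ∑ j, γ j * P.uFrac j ^ k) (i : Fin r)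
    (k : ℕ) :
    aeval (P.uFrac i) (P.twistPoly k) = P.ρFrac⁻¹ + P.zFrac / (P.uFrac i ^ 2 - 1) +
      P.zFrac * ∑ j, γ j / (1 - P.uFrac j * P.uFrac i) +
      P.uFrac i ^ k * gOp P.uFrac P.zFrac γ (P.nodeVec k) i := by
  induction k with
  | zero =>
    rw [twistPoly, aeval_C, algebraMap_ρ_inv, gOp_apply, nodeVec_zero]
    simp only [Pi.one_apply, mul_one, pow_zero, one_mul]
    ring
  | succ k ih =>
    have h1 := congrFun (mul_gOp_mul (z := P.zFrac) (γ := γ) hu (P.nodeVec k)) i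
    have h2 : P.uFrac * P.nodeVec k = P.nodeVec (k + 1) := by
      funext i
      rw [Pi.mul_apply, nodeVec, nodeVec, pow_succ']
    have h3 : eOp γ (P.nodeVec k) i = algebraMap S (FractionRing S) (P.δ k) := (hγ k).symm
    have h4 : P.nodeVec k i = P.uFrac i ^ k := rfl
    rw [h2, Pi.mul_apply, Pi.sub_apply, Pi.smul_apply, Pi.sub_apply, h3, h4, smul_eq_mul] at h1
    rw [twistPoly, map_sub, ih]
    simp only [map_mul, aeval_C, map_sub, map_pow, aeval_X, ← zFrac.eq_1]
    linear_combination -P.uFrac i ^ k * h1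

/-- The Vandermonde system settles `k < r`. Both sides satisfy the same linear recursion of order
`r` with leading coefficient `1`, which settles the rest. -/
theorem IsWeaklyAdmissible.exists_weights (h : P.IsWeaklyAdmissible)
    (hu : GenericNodes P.uFrac) : ∃ γ : Fin r → FractionRing S,
      ∀ k, algebraMap S (FractionRing S) (P.δ k) = ∑ j, γ j * P.uFrac j ^ k := by
  have hV : IsUnit (Matrix.vandermonde P.uFrac).transpose := by
    rw [Matrix.isUnit_transpose, Matrix.isUnit_iff_isUnit_det, isUnit_iff_ne_zero]
    exact Matrix.det_vandermonde_ne_zero_iff.mpr hu.injective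
  obtain ⟨γ, hγ⟩ := (Matrix.mulVec_surjective_iff_isUnit.mpr hV)
    fun k : Fin r => algebraMap S (FractionRing S) (P.δ k)
  refine ⟨γ, fun k => ?_⟩
  induction k using Nat.strong_induction_on with
  | _ k ih =>
    rcases lt_or_ge k r with hk | hk
    · have := congrFun hγ ⟨k, hk⟩
      rw [← this, Matrix.mulVec, dotProduct]
      exact Finset.sum_congr rfl fun j _ => mul_comm _ _
    · have h1 := congrArg (algebraMap S (FractionRing S)) (h ((k - r : ℕ) : ℤ))
      have h2 : ∑ j, γ j * P.uFrac j ^ (k - r) *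
          ∑ m ∈ Finset.range (r + 1), (nodePoly P.uFrac).coeff m * P.uFrac j ^ m = 0 :=
        Finset.sum_eq_zero fun j _ => by rw [sum_nodePoly_coeff_mul_pow, mul_zero]
      have h3 (m : ℕ) (hm : m ≤ r) : algebraMap S (FractionRing S)
          (P.a m * P.δInt ((m : ℤ) + ((k - r : ℕ) : ℤ))) = (nodePoly P.uFrac).coeff m *
            algebraMap S (FractionRing S) (P.δ (m + (k - r))) := by
        rw [← Nat.cast_add, δInt_natCast, map_mul, P.algebraMap_a hm]
      have h4 : ∑ m ∈ Finset.range (r + 1), (nodePoly P.uFrac).coeff m *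
          ∑ j, γ j * P.uFrac j ^ (m + (k - r)) = 0 := by
        rw [← h2]
        simp only [Finset.mul_sum]
        rw [Finset.sum_comm]
        exact Finset.sum_congr rfl fun j _ => Finset.sum_congr rfl fun m _ => by ring
      rw [map_sum, map_zero, Finset.sum_congr rfl fun m hm =>
        h3 m (by have := Finset.mem_range.mp hm; omega)] at h1
      rw [← h4, Finset.sum_range_succ, Finset.sum_range_succ] at h1
      have h5 : (nodePoly P.uFrac).coeff r = 1 := by
        have := (nodePoly_monic P.uFrac).coeff_natDegree
        rwa [nodePoly_natDegree] at this
      rw [Finset.sum_congr rfl fun m hm => by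
        rw [ih (m + (k - r)) (by have := Finset.mem_range.mp hm; omega)]] at h1
      rw [h5, one_mul, one_mul, show r + (k - r) = k by omega] at h1
      exact add_left_cancel h1

theorem LinearIndependenceCondition.deltaFormulaCondition (h : P.LinearIndependenceCondition)
    (hu : GenericNodes P.uFrac) (hz : P.qDiff ≠ 0) : P.DeltaFormulaCondition := by
  obtain ⟨γ, hγ⟩ := h.1.exists_weights hu
  have hC : CauchySystem P.uFrac P.ρFrac P.zFrac γ := by
    intro i
    have h1 := h.aeval_uFrac_eq_zero P.aeval_y_sum_twistPoly i
    have hrev : (revNodePoly P.uFrac).eval (P.uFrac i) =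
        ∑ k ∈ Finset.range (r + 1), (nodePoly P.uFrac).coeff k * P.uFrac i ^ (r - k) := by
      have hdeg : (revNodePoly P.uFrac).natDegree < r + 1 := by
        have := natDegree_le_of_degree_le (revNodePoly_degree_le P.uFrac)
        omega
      rw [eval_eq_sum_range' hdeg, ← Finset.sum_range_reflect]
      refine Finset.sum_congr rfl fun k hk => ?_
      have := Finset.mem_range.mp hk
      rw [revNodePoly_coeff _ (by omega), show r - (r + 1 - 1 - k) = k by omega,
        show r + 1 - 1 - k = r - k by omega]
    have hrev0 : (revNodePoly P.uFrac).eval (P.uFrac i) ≠ 0 := by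
      rw [revNodePoly_eval]
      exact Finset.prod_ne_zero_iff.mpr fun l _ => hu.one_sub_ne l i
    -- The vector `∑ a_k u^k` of values of `nodePoly` at the nodes is zero, hence so is its image
    -- under `gOp`.
    have h2 : ∑ k ∈ Finset.range (r + 1), (nodePoly P.uFrac).coeff k *
        gOp P.uFrac P.zFrac γ (P.nodeVec k) i = 0 := by
      have h3 : ∑ k ∈ Finset.range (r + 1), (nodePoly P.uFrac).coeff k • P.nodeVec k = 0 := by
        funext j
        rw [Finset.sum_apply]
        exact sum_nodePoly_coeff_mul_pow P.uFrac j
      have h4 := congrFun (congrArg (gOp P.uFrac P.zFrac γ) h3) i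
      rw [map_sum, Finset.sum_apply, map_zero] at h4
      simpa only [map_smul, Pi.smul_apply, smul_eq_mul, Pi.zero_apply] using h4
    -- In the value of the annihilating polynomial, the `gOp` terms add up to `u_i^r` times the sum
    -- in `h2`; what remains is the Cauchy expression times `revNodePoly` at `u_i`.
    refine (mul_eq_zero.mp ?_).resolve_left hrev0
    refine Eq.trans ?_ h1
    rw [hrev, Finset.sum_mul, ← add_zero (Finset.sum _ _), ← mul_zero (P.uFrac i ^ r), ← h2,
      map_sum, Finset.mul_sum _ _ (P.uFrac i ^ r), ← Finset.sum_add_distrib]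
    refine Finset.sum_congr rfl fun k hk => ?_
    have hk' : r = r - k + k := by have := Finset.mem_range.mp hk; omega
    rw [map_mul, aeval_C, map_mul, map_pow, aeval_X, aeval_twistPoly hu hγ, cyclotomicPoly_coeff]
    have : P.uFrac i ^ r = P.uFrac i ^ (r - k) * P.uFrac i ^ k := by rw [← pow_add, ← hk']
    rw [this]
    ring
  rw [cauchySystem_iff_eq_nodeWeight hu P.ρFrac_ne_zero (zFrac_ne_zero hz), ← γ_eq_nodeWeight]
    at hC
  rw [hC] at hγ
  exact hγ

end Integral

end GroundRingParameters

/-! ### Comparison of the two notions of admissibility. -/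

open GroundRingParameters in
/-- An integral ground ring is `u`-admissible if and only if it is admissible, the `u_i` are distinct and
`u_i u_j ≠ 1` for all `i, j`. This holds whichever of the equivalent conditions is taken in the definition
of `u`-admissibility (`c`) and in the definition of admissibility (`d`). -/
theorem mainTheorem8 {S : Type u} [CommRing S] [IsDomain S] {r : ℕ}
    (P : GroundRingParameters S r)
    (c : GroundRingParameters.UAdmissibilityForm)
    (d : GroundRingParameters.AdmissibilityForm) :
    P.IsUAdmissible c ↔
      P.IsAdmissible d ∧ (∀ i j : Fin r, i ≠ j → P.u i ≠ P.u j) ∧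
        ∀ i j : Fin r, (P.u i : S) * (P.u j : S) ≠ 1 := by
  have key (hz : P.qDiff ≠ 0) (h1 : ∀ i j : Fin r, i ≠ j → P.u i ≠ P.u j)
      (h2 : ∀ i j : Fin r, (P.u i : S) * (P.u j : S) ≠ 1) :
      P.UAdmissibilityCondition c ↔ P.AdmissibilityCondition d := by
    have hu := genericNodes h1 h2
    have hL : P.LinearIndependenceCondition ↔ P.DeltaFormulaCondition :=
      ⟨fun h => h.deltaFormulaCondition hu hz,
        fun h => (h.basisModuleCondition hu hz).linearIndependenceCondition⟩
    have hM : P.BasisModuleCondition ↔ P.DeltaFormulaCondition :=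
      ⟨fun h => h.linearIndependenceCondition.deltaFormulaCondition hu hz,
        fun h => h.basisModuleCondition hu hz⟩
    have hc : P.UAdmissibilityCondition c ↔ P.DeltaFormulaCondition := by
      cases c with
      | linearIndependence => exact hL
      | deltaFormula => exact Iff.rfl
      | basisModule => exact hM
    have hd : P.AdmissibilityCondition d ↔ P.DeltaFormulaCondition := by
      cases d with
      | linearIndependence => exact hL
      | wilcoxYuRelations => exact wilcoxYu_iff_deltaFormula hu hz
      | basisModule => exact hM
    rw [hc, hd]
  constructor
  · rintro ⟨hz, h1, h2, h⟩
    exact ⟨⟨hz, mem_nonZeroDivisors_of_ne_zero hz, (key hz h1 h2).mp h⟩, h1, h2⟩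
  · rintro ⟨⟨hz, -, h⟩, h1, h2⟩
    exact ⟨hz, h1, h2, (key hz h1 h2).mpr h⟩
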